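/- Let $n\ge 1$. A weight on $\mathbb R^n$ is a locally integrable function $w$ with $w>0$ almost everywhere. For $1<r<\infty$ put $$\|w\|_{A_r}=\sup_Q\Big(\frac1{|Q|}\int_Q w\Big)\Big(\frac1{|Q|}\int_Q w^{-1/(r-1)}\Big)^{r-1},\qquad \|w\|_{A_1}=\sup_Q\Big(\frac1{|Q|}\int_Q w\Big)\,\operatorname*{ess\,sup}_{Q}\,w^{-1},$$ the suprema being over all cubes $Q\subset\mathbb R^n$ with sides parallel to the axes, and write $w\in A_r$ if $\|w\|_{A_r}<\infty$. For measurable $f,g\ge 0$ put $\|f\|_{L^r(w)}=\big(\int_{\mathbb R^n} f^r w\,dx\big)^{1/r}$ and $\|g\|_{L^{r,\infty}(w)}=\sup_{y>0}\,y\,\Big(\int_{\{g>y\}}w\,dx\Big)^{1/r}$. **Theorem 3.1 (weak-type Rubio de Francia extrapolation).** Let $1\le p_0<\infty$, let $1<p<\infty$, and let $\varphi:[0,\infty)\to[0,\infty)$ be locally bounded, i.e. $\sup_{0<t<M}\varphi(t)<\infty$ for every $M>0$. Let $f,g:\mathbb R^n\to[0,\infty]$ be measurable functions such that $$\|g\|_{L^{p_0,\infty}(w)}\le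 \varphi(\|w\|_{A_{p_0}})\,\|f\|_{L^{p_0}(w)}\qquad\text{for every } w\in A_{p_0}.$$ Then $$\|g\|_{L^{p,\infty}(w)}\le C_w\,\|f\|_{L^{p}(w)}\qquad\text{for every } w\in A_{p},$$ where $C_w<\infty$ depends only on $n$, $p_0$, $p$, $\varphi$ and $\|w\|_{A_p}$, and not on $f$ and $g$. -/

import Mathlib

open MeasureTheory Set
open scoped ENNReal NNReal

noncomputable section

/-- The closed cube `∏ᵢ [aᵢ, aᵢ + ℓ]` in `ℝⁿ`, with sides parallel to the axes, lower corner `a`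
and side length `ℓ`. -/
def cube {n : ℕ} (a : Fin n → ℝ) (ℓ : ℝ) : Set (Fin n → ℝ) :=
  Icc a (fun i => a i + ℓ)

/-- A weight on `ℝⁿ`: a Lebesgue measurable, locally integrable function that is positive almost
everywhere. (Values are taken in `[0, ∞]`; local integrability makes `w` finite a.e.) -/
structure IsWeight {n : ℕ} (w : (Fin n → ℝ) → ℝ≥0∞) : Prop where
  aemeasurable : AEMeasurable w volume
  ae_pos : ∀ᵐ x, 0 < w x
  locallyIntegrable : ∀ K : Set (Fin n → ℝ), IsCompact K → ∫⁻ x in K, w x < ∞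

/-- The Muckenhoupt constant `‖w‖_{A_p}`, `1 ≤ p < ∞`, where the supremum runs over all cubes `Q`:
`sup_Q (⨍_Q w) (⨍_Q w^{-1/(p-1)})^{p-1}` for `p > 1`, and
`sup_Q (⨍_Q w) (ess sup_Q w⁻¹)` for `p = 1`. -/
def ApConst {n : ℕ} (p : ℝ) (w : (Fin n → ℝ) → ℝ≥0∞) : ℝ≥0∞ :=
  if p = 1 then
    ⨆ (a : Fin n → ℝ) (ℓ : ℝ) (_ : 0 < ℓ),
      (⨍⁻ x in cube a ℓ, w x ∂volume) * essSup (fun x => (w x)⁻¹) (volume.restrict (cube a ℓ))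
  else
    ⨆ (a : Fin n → ℝ) (ℓ : ℝ) (_ : 0 < ℓ),
      (⨍⁻ x in cube a ℓ, w x ∂volume) * (⨍⁻ x in cube a ℓ, (w x) ^ (-1 / (p - 1)) ∂volume) ^ (p - 1)

/-- The Muckenhoupt class `A_p`. -/
def IsAp {n : ℕ} (p : ℝ) (w : (Fin n → ℝ) → ℝ≥0∞) : Prop :=
  IsWeight w ∧ ApConst p w < ∞

/-- The distribution function `λ_g^w(y) = w({x : g(x) > y})` of `g ≥ 0` with respect to the
measure `w(x) dx`. -/
def distribFun {n : ℕ} (w g : (Fin n → ℝ) → ℝ≥0∞) (y : ℝ≥0) : ℝ≥0∞ :=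
  volume.withDensity w {x | (y : ℝ≥0∞) < g x}

/-- `‖g‖_{L^{p,∞}(w)} = sup_{y > 0} y λ_g^w(y)^{1/p}`. -/
def weakLpNorm {n : ℕ} (p : ℝ) (w g : (Fin n → ℝ) → ℝ≥0∞) : ℝ≥0∞ :=
  ⨆ (y : ℝ≥0) (_ : 0 < y), (y : ℝ≥0∞) * distribFun w g y ^ (1 / p)

/-- `‖f‖_{L^p(w)} = (∫ f^p w dx)^{1/p}` for `f ≥ 0`. -/
def strongLpNorm {n : ℕ} (p : ℝ) (w f : (Fin n → ℝ) → ℝ≥0∞) : ℝ≥0∞ :=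
  (∫⁻ x, f x ^ p * w x) ^ (1 / p)

/-- `φ : [0, ∞) → [0, ∞)` is locally bounded: `sup_{0 < t < M} φ(t) < ∞` for every `M`. -/
def IsLocBdd (φ : ℝ≥0 → ℝ≥0) : Prop :=
  ∀ M : ℝ≥0, BddAbove (φ '' Ioo 0 M)

end

open Metric

/-! Fix `w ∈ A_p`, put `σ = w^{-1/(p-1)}` and `p' = p/(p-1)`, and let `E` be a bounded part of `{g >
y}`. Rubio de Francia's algorithm gives `F ≥ f` and `U ≥ 1_E w` with `MF ≤ c₁F`, `MU ≤ c₂U`, whose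
norms in `L^p(w)` and `L^{p'}(σ)` are at most twice those of `f` and `1_E w`. Then `W = F^{1-p₀}U`
is in `A_{p₀}` with constant at most `c₁^{p₀-1}c₂`, so the hypothesis applies to `W`
(`isAp_factored`). Since `f ≤ F`, its right side is at most `φ (∫FU)^{1/p₀}`, and Hölder turns its
left side into `U(E)`: `y U(E) ≤ φ ∫FU` (`mul_lintegral_le_of_factored`). As `w ≤ U` on `E` and `∫FU
≤ 4 ‖f‖_{L^p(w)} w(E)^{1/p'}`, division by `w(E)^{1/p'}` finishes the proof, with no distinction
between `p < p₀` and `p > p₀`.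

The algorithm needs `M` bounded on `L^p(w)` and on `L^{p'}(σ)`, which is Muckenhoupt's theorem
(`lintegral_cubeMaximal_rpow_mul_le`). There `(Mf)^{q-1}` is dominated pointwise by two nested
maximal functions, for `σ dx` and `w dx`. Each divides by the measure of the fivefold cube, so
Vitali covering bounds it with a constant independent of the measure, without doubling; the `A_q`
condition on the fivefold cube pays for the enlargement. -/

/-! ### Layer-cake formulas -/

/-- Layer-cake formula for a single extended nonnegative number. -/
theorem ennreal_rpow_eq_lintegral {q : ℝ} (hq : 0 < q) (x : ℝ≥0∞) :
    x ^ q = ∫⁻ t in Ioi (0 : ℝ),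
      {t : ℝ | ENNReal.ofReal t < x}.indicator (fun t => ENNReal.ofReal (q * t ^ (q - 1))) t := by
  have key : ∀ a : ℝ, 0 ≤ a → ∫⁻ t in Ioo (0 : ℝ) a, ENNReal.ofReal (q * t ^ (q - 1)) =
      ENNReal.ofReal a ^ q := by
    intro a ha
    have hint : IntervalIntegrable (fun t : ℝ => q * t ^ (q - 1)) volume 0 a :=
      (intervalIntegral.intervalIntegrable_rpow' (by linarith)).const_mul q
    rw [restrict_Ioo_eq_restrict_Ioc, ← ofReal_integral_eq_lintegral_ofReal,
      ← intervalIntegral.integral_of_le ha, intervalIntegral.integral_const_mul,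
      integral_rpow (Or.inl (by linarith)), ENNReal.ofReal_rpow_of_nonneg ha hq.le]
    · congr 1
      rw [sub_add_cancel, Real.zero_rpow hq.ne']
      field_simp
      ring
    · exact (intervalIntegrable_iff_integrableOn_Ioc_of_le ha).1 hint
    · refine (ae_restrict_iff' measurableSet_Ioc).2 (ae_of_all _ fun t ht => ?_)
      have := Real.rpow_nonneg ht.1.le (q - 1)
      simp only [Pi.zero_apply]
      positivity
  have hms : MeasurableSet {t : ℝ | ENNReal.ofReal t < x} :=
    measurableSet_lt ENNReal.measurable_ofReal measurable_const
  rw [lintegral_indicator hms, Measure.restrict_restrict hms]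
  by_cases hx : x = ∞
  · subst hx
    rw [ENNReal.top_rpow_of_pos hq]
    symm
    rw [eq_top_iff]
    refine ENNReal.le_of_forall_nnreal_lt fun r _ => ?_
    have hr : (r : ℝ≥0∞) = ENNReal.ofReal ((r : ℝ) ^ q⁻¹) ^ q := by
      rw [ENNReal.ofReal_rpow_of_nonneg (by positivity) hq.le, Real.rpow_inv_rpow (by positivity)
        hq.ne', ENNReal.ofReal_coe_nnreal]
    rw [hr, ← key _ (by positivity)]
    refine lintegral_mono_set fun t ht => ⟨by simp, ht.1⟩
  · have : {t : ℝ | ENNReal.ofReal t < x} ∩ Ioi 0 = Ioo 0 x.toReal := by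
      ext t
      simp only [mem_inter_iff, mem_ofPred_eq, mem_Ioi, mem_Ioo]
      rw [and_comm]
      refine and_congr_right fun ht => ?_
      rw [ENNReal.ofReal_lt_iff_lt_toReal ht.le hx]
    rw [this, key _ ENNReal.toReal_nonneg, ENNReal.ofReal_toReal hx]

/-- Layer-cake formula for extended nonnegative functions. -/
theorem lintegral_rpow_eq_lintegral_distribution {X : Type*} [MeasurableSpace X] (μ : Measure X)
    [SFinite μ] {q : ℝ} (hq : 0 < q) {f : X → ℝ≥0∞} (hf : Measurable f) :
    ∫⁻ x, f x ^ q ∂μ =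
      ∫⁻ t in Ioi (0 : ℝ), ENNReal.ofReal (q * t ^ (q - 1)) * μ {x | ENNReal.ofReal t < f x} := by
  have hms : MeasurableSet {z : X × ℝ | ENNReal.ofReal z.2 < f z.1} :=
    measurableSet_lt (ENNReal.measurable_ofReal.comp measurable_snd) (hf.comp measurable_fst)
  have hm : Measurable fun z : X × ℝ =>
      {t : ℝ | ENNReal.ofReal t < f z.1}.indicator
        (fun t => ENNReal.ofReal (q * t ^ (q - 1))) z.2 := by
    have : Measurable ({z : X × ℝ | ENNReal.ofReal z.2 < f z.1}.indicator
        (fun z => ENNReal.ofReal (q * z.2 ^ (q - 1)))) :=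
      Measurable.indicator (by fun_prop) hms
    exact this
  simp_rw [ennreal_rpow_eq_lintegral hq]
  rw [lintegral_lintegral_swap hm.aemeasurable]
  refine lintegral_congr fun t => ?_
  have : ∀ x, {t : ℝ | ENNReal.ofReal t < f x}.indicator
        (fun t => ENNReal.ofReal (q * t ^ (q - 1))) t =
      {x | ENNReal.ofReal t < f x}.indicator (fun _ => ENNReal.ofReal (q * t ^ (q - 1))) x := by
    intro x; simp [indicator]
  simp_rw [this]
  rw [lintegral_indicator_const (measurableSet_lt measurable_const hf)]

/-! ### Maximal operators with enlarged denominators -/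

section BallSup
variable {X : Type*} [PseudoMetricSpace X]

/-- The supremum of a ball functional over all open balls containing a given point. -/
noncomputable def ballSup (a : X → ℝ → ℝ≥0∞) (x : X) : ℝ≥0∞ :=
  ⨆ (y : X) (r : ℝ) (_ : x ∈ ball y r), a y r

theorem le_ballSup (a : X → ℝ → ℝ≥0∞) {x y : X} {r : ℝ} (h : x ∈ ball y r) :
    a y r ≤ ballSup a x :=
  le_iSup_of_le y (le_iSup_of_le r (le_iSup_of_le h le_rfl))

theorem ballSup_le {a : X → ℝ → ℝ≥0∞} {x : X} {c : ℝ≥0∞}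
    (h : ∀ y r, x ∈ ball y r → a y r ≤ c) : ballSup a x ≤ c :=
  iSup_le fun y => iSup_le fun r => iSup_le fun hx => h y r hx

theorem lt_ballSup_iff {a : X → ℝ → ℝ≥0∞} {x : X} {c : ℝ≥0∞} :
    c < ballSup a x ↔ ∃ y r, x ∈ ball y r ∧ c < a y r := by
  simp [ballSup, lt_iSup_iff]

/-- Superlevel sets are unions of open balls, so maximal functions are measurable whatever the
functional `a`. -/
theorem lowerSemicontinuous_ballSup (a : X → ℝ → ℝ≥0∞) : LowerSemicontinuous (ballSup a) := by
  rw [lowerSemicontinuous_iff_isOpen_preimage]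
  intro c
  have : ballSup a ⁻¹' Ioi c = ⋃ (y : X) (r : ℝ) (_ : c < a y r), ball y r := by
    ext x
    simp only [mem_preimage, mem_Ioi, lt_ballSup_iff, mem_iUnion, exists_prop]
    exact exists_congr fun _ => exists_congr fun _ => and_comm
  rw [this]
  exact isOpen_iUnion fun _ => isOpen_iUnion fun _ => isOpen_iUnion fun _ => isOpen_ball

variable [MeasurableSpace X] [BorelSpace X]

theorem measurable_ballSup (a : X → ℝ → ℝ≥0∞) : Measurable (ballSup a) :=
  (lowerSemicontinuous_ballSup a).measurable

/-- The maximal operator of a measure `μ` in which each average over a ball is replaced by the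
integral over that ball divided by the measure of the five times larger ball. -/
noncomputable def enlargedMaximal (μ : Measure X) (f : X → ℝ≥0∞) : X → ℝ≥0∞ :=
  ballSup fun y r => (∫⁻ z in ball y r, f z ∂μ) / μ (closedBall y (5 * r))

theorem measurable_enlargedMaximal (μ : Measure X) (f : X → ℝ≥0∞) :
    Measurable (enlargedMaximal μ f) :=
  measurable_ballSup _

variable [SecondCountableTopology X]

/-- Weak type `(1,1)` with constant one, by the Vitali covering lemma. -/
theorem mul_measure_lt_enlargedMaximal_le (μ : Measure X) (f : X → ℝ≥0∞)
    (t : ℝ≥0∞) : t * μ {x | t < enlargedMaximal μ f x} ≤ ∫⁻ x, f x ∂μ := by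
  -- Vitali's lemma needs bounded radii, hence the cap `R`, removed by monotone exhaustion.
  let T : ℕ → Set (X × ℝ) := fun R => {i | 0 < i.2 ∧ i.2 ≤ R ∧
    t < (∫⁻ z in ball i.1 i.2, f z ∂μ) / μ (closedBall i.1 (5 * i.2))}
  let O : ℕ → Set X := fun R => ⋃ i ∈ T R, ball i.1 i.2
  have hO : {x | t < enlargedMaximal μ f x} = ⋃ R, O R := by
    ext x
    simp only [mem_ofPred_eq, enlargedMaximal, lt_ballSup_iff, mem_iUnion, O, T]
    constructor
    · rintro ⟨y, r, hx, h⟩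
      obtain ⟨R, hR⟩ := exists_nat_ge r
      exact ⟨R, (y, r), ⟨pos_of_mem_ball hx, hR, h⟩, hx⟩
    · rintro ⟨R, ⟨y, r⟩, ⟨_, _, h⟩, hx⟩
      exact ⟨y, r, hx, h⟩
  have hmono : Monotone O := by
    intro R S hRS
    refine biUnion_mono ?_ fun _ _ => le_rfl
    intro i hi
    exact ⟨hi.1, hi.2.1.trans (by exact_mod_cast hRS), hi.2.2⟩
  rw [hO, hmono.measure_iUnion, ENNReal.mul_iSup]
  refine iSup_le fun R => ?_
  obtain ⟨u, huT, hdisj, hcov⟩ := Vitali.exists_disjoint_subfamily_covering_enlargement_closedBall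
    (T R) Prod.fst Prod.snd R (fun i hi => hi.2.1) 5 (by norm_num)
  have hdisj' : u.PairwiseDisjoint fun i => ball i.1 i.2 :=
    hdisj.mono_on fun i _ => ball_subset_closedBall
  have hucount : u.Countable := hdisj'.countable_of_isOpen (fun i _ => isOpen_ball)
    fun i hi => nonempty_ball.2 (huT hi).1
  have hsub : O R ⊆ ⋃ i ∈ u, closedBall i.1 (5 * i.2) := by
    refine iUnion₂_subset fun i hi => ?_
    obtain ⟨j, hj, hij⟩ := hcov i hi
    exact (ball_subset_closedBall.trans hij).trans
      (subset_biUnion_of_mem (u := fun k : X × ℝ => closedBall k.1 (5 * k.2)) hj)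
  calc t * μ (O R) ≤ t * ∑' i : u, μ (closedBall (i : X × ℝ).1 (5 * (i : X × ℝ).2)) := by
        gcongr
        exact (measure_mono hsub).trans (measure_biUnion_le μ hucount _)
    _ = ∑' i : u, t * μ (closedBall (i : X × ℝ).1 (5 * (i : X × ℝ).2)) := ENNReal.tsum_mul_left.symm
    _ ≤ ∑' i : u, ∫⁻ z in ball (i : X × ℝ).1 (i : X × ℝ).2, f z ∂μ := by
        refine ENNReal.tsum_le_tsum fun i => ?_
        exact ENNReal.mul_le_of_le_div (huT i.2).2.2.le
    _ = ∫⁻ z in ⋃ i ∈ u, ball i.1 i.2, f z ∂μ :=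
        (lintegral_biUnion hucount (fun _ _ => measurableSet_ball) hdisj' f).symm
    _ ≤ ∫⁻ x, f x ∂μ := setLIntegral_le_lintegral _ _

/-- Cut `f` at height `t/2`: the low part adds at most `t/2` to every ratio, because a ball has no
more mass than its enlargement, so the high part must exceed `t/2` and the weak type bound applies
to it. -/
theorem mul_measure_lt_enlargedMaximal_le_truncated (μ : Measure X) {f : X → ℝ≥0∞}
    (hf : Measurable f) (t : ℝ≥0∞) :
    t * μ {x | t < enlargedMaximal μ f x} ≤ 2 * ∫⁻ x in {x | t < 2 * f x}, f x ∂μ := by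
  have hms : MeasurableSet {x | t < 2 * f x} := measurableSet_lt measurable_const (hf.const_mul 2)
  set f₁ : X → ℝ≥0∞ := {x | t < 2 * f x}.indicator f with hf₁
  have hle : ∀ x, f x ≤ f₁ x + t / 2 := by
    intro x
    by_cases hx : t < 2 * f x
    · rw [hf₁, indicator_of_mem (by exact hx)]; exact le_self_add
    · have : f x ≤ t / 2 := by
        rw [ENNReal.le_div_iff_mul_le (by simp) (by simp), mul_comm]; exact not_lt.1 hx
      exact this.trans le_add_self
  have hsub : {x | t < enlargedMaximal μ f x} ⊆ {x | t / 2 < enlargedMaximal μ f₁ x} := by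
    intro x hx
    obtain ⟨y, r, hxr, h⟩ := lt_ballSup_iff.1 hx
    refine lt_ballSup_iff.2 ⟨y, r, hxr, ?_⟩
    by_contra! hcon
    refine absurd h (not_lt.2 ?_)
    have hr := pos_of_mem_ball hxr
    calc (∫⁻ z in ball y r, f z ∂μ) / μ (closedBall y (5 * r))
        ≤ (∫⁻ z in ball y r, (f₁ z + t / 2) ∂μ) / μ (closedBall y (5 * r)) := by
          gcongr with z; exact hle z
      _ = (∫⁻ z in ball y r, f₁ z ∂μ) / μ (closedBall y (5 * r)) +
          t / 2 * μ (ball y r) / μ (closedBall y (5 * r)) := by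
          rw [lintegral_add_right _ measurable_const, setLIntegral_const, ENNReal.add_div]
      _ ≤ t / 2 + t / 2 := by
          refine add_le_add hcon ?_
          rw [mul_div_assoc]
          refine mul_le_of_le_one_right' ?_
          refine ENNReal.div_le_of_le_mul ?_
          rw [one_mul]
          exact measure_mono (ball_subset_closedBall.trans
            (closedBall_subset_closedBall (by linarith)))
      _ = t := ENNReal.add_halves t
  calc t * μ {x | t < enlargedMaximal μ f x}
      ≤ 2 * (t / 2 * μ {x | t / 2 < enlargedMaximal μ f₁ x}) := by
        rw [← mul_assoc, ENNReal.mul_div_cancel (by simp) (by simp)]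
        gcongr
    _ ≤ 2 * ∫⁻ x, f₁ x ∂μ := by
        gcongr
        exact mul_measure_lt_enlargedMaximal_le μ f₁ _
    _ = _ := by rw [hf₁, lintegral_indicator hms]

/-- Strong type `(q,q)` of the enlarged maximal operator, with a constant that does not depend on
the measure. -/
theorem lintegral_enlargedMaximal_rpow_le (μ : Measure X) [SFinite μ] {q : ℝ} (hq : 1 < q)
    {f : X → ℝ≥0∞} (hf : Measurable f) :
    ∫⁻ x, enlargedMaximal μ f x ^ q ∂μ ≤
      ENNReal.ofReal (2 ^ q * q / (q - 1)) * ∫⁻ x, f x ^ q ∂μ := by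
  have hq1 : 0 < q - 1 := by linarith
  -- With `ν = f dμ` the truncated integrals become a distribution function, so the layer-cake
  -- formula can be run backwards with exponent `q - 1`.
  let ν : Measure X := μ.withDensity f
  have hν : ∀ t : ℝ, ν {x | ENNReal.ofReal t < 2 * f x} =
      ∫⁻ x in {x | ENNReal.ofReal t < 2 * f x}, f x ∂μ := fun t =>
    withDensity_apply _ (measurableSet_lt measurable_const (hf.const_mul 2))
  rw [lintegral_rpow_eq_lintegral_distribution μ (by linarith : 0 < q)
    (measurable_enlargedMaximal μ f)]
  calc ∫⁻ t in Ioi (0 : ℝ), ENNReal.ofReal (q * t ^ (q - 1)) *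
        μ {x | ENNReal.ofReal t < enlargedMaximal μ f x}
      ≤ ∫⁻ t in Ioi (0 : ℝ), ENNReal.ofReal (2 * q / (q - 1)) *
        (ENNReal.ofReal ((q - 1) * t ^ (q - 1 - 1)) * ν {x | ENNReal.ofReal t < 2 * f x}) := by
        refine setLIntegral_mono' measurableSet_Ioi fun t ht => ?_
        have ht : 0 < t := ht
        have e1 : q * t ^ (q - 1) = (q * t ^ (q - 1 - 1)) * t := by
          rw [mul_assoc, ← Real.rpow_add_one ht.ne', sub_add_cancel]
        have e2 : ENNReal.ofReal (2 * q / (q - 1)) * ENNReal.ofReal ((q - 1) * t ^ (q - 1 - 1)) =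
            ENNReal.ofReal (q * t ^ (q - 1 - 1)) * 2 := by
          rw [← ENNReal.ofReal_mul (by positivity), ← ENNReal.ofReal_ofNat 2,
            ← ENNReal.ofReal_mul (by positivity)]
          congr 1
          field_simp
        rw [e1, ENNReal.ofReal_mul (by positivity), mul_assoc, ← mul_assoc (ENNReal.ofReal (2 * _ / _)),
          e2, mul_assoc, hν]
        exact mul_le_mul' le_rfl
          (mul_measure_lt_enlargedMaximal_le_truncated μ hf _)
    _ = ENNReal.ofReal (2 * q / (q - 1)) * ∫⁻ x, (2 * f x) ^ (q - 1) ∂ν := by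
        rw [lintegral_const_mul' _ _ ENNReal.ofReal_ne_top,
          lintegral_rpow_eq_lintegral_distribution ν hq1 (hf.const_mul 2)]
    _ = ENNReal.ofReal (2 ^ q * q / (q - 1)) * ∫⁻ x, f x ^ q ∂μ := by
        rw [lintegral_withDensity_eq_lintegral_mul _ hf (by fun_prop)]
        have : ∀ x, (f * fun x => (2 * f x) ^ (q - 1)) x = 2 ^ (q - 1) * f x ^ q := by
          intro x
          have : f x ^ q = f x * f x ^ (q - 1) := by
            conv_rhs => rw [← ENNReal.rpow_one (f x), ← ENNReal.rpow_mul, one_mul,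
              ← ENNReal.rpow_add_of_nonneg _ _ zero_le_one hq1.le]
            congr 1; ring
          rw [Pi.mul_apply, ENNReal.mul_rpow_of_nonneg _ _ hq1.le, this]
          ring
        simp_rw [this]
        rw [lintegral_const_mul _ (by fun_prop), ← mul_assoc]
        congr 1
        rw [← ENNReal.ofReal_ofNat 2, ENNReal.ofReal_rpow_of_pos (by norm_num),
          ← ENNReal.ofReal_mul (by positivity)]
        congr 1
        have : (2 : ℝ) ^ q = 2 * 2 ^ (q - 1) := by
          rw [Real.rpow_sub_one (by norm_num)]; ring
        rw [this]; ring

end BallSup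

/-! ### Muckenhoupt's theorem -/

section Cubes
variable {n : ℕ}

/-- The uncentered Hardy–Littlewood maximal function over cubes. -/
noncomputable def cubeMaximal (f : (Fin n → ℝ) → ℝ≥0∞) : (Fin n → ℝ) → ℝ≥0∞ :=
  ballSup fun y r => ⨍⁻ z in ball y r, f z ∂volume

theorem measurable_cubeMaximal (f : (Fin n → ℝ) → ℝ≥0∞) : Measurable (cubeMaximal f) :=
  measurable_ballSup _

theorem volume_closedBall_five_mul (y : Fin n → ℝ) {r : ℝ} (hr : 0 < r) :
    volume (closedBall y (5 * r)) = 5 ^ n * volume (ball y r) := by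
  rw [Real.volume_pi_closedBall _ (by positivity), Real.volume_pi_ball _ hr, Fintype.card_fin,
    show 2 * (5 * r) = 5 * (2 * r) by ring, mul_pow, ENNReal.ofReal_mul (by positivity),
    ENNReal.ofReal_pow (by norm_num), ENNReal.ofReal_ofNat]

theorem laverage_pos_of_pos {w : (Fin n → ℝ) → ℝ≥0∞} (hw : Measurable w) (hw0 : ∀ x, w x ≠ 0)
    (y : Fin n → ℝ) {r : ℝ} (hr : 0 < r) : ⨍⁻ x in closedBall y r, w x ∂volume ≠ 0 := by
  rw [setLAverage_eq]
  refine (ENNReal.div_pos ?_ measure_closedBall_lt_top.ne).ne'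
  rw [← pos_iff_ne_zero, setLIntegral_pos_iff hw]
  have : Function.support w = univ := by ext x; simp [hw0 x]
  rw [this, univ_inter]
  exact measure_closedBall_pos _ _ hr

/-- Identifies `∫ G^{q'} w` with `∫ N^q σ` for `G = N^{q-1}/w`, linking the two maximal operators in
Muckenhoupt's theorem. -/
theorem rpow_sub_one_div_rpow_mul {q : ℝ} (hq : 1 < q) {w : ℝ≥0∞} (hw0 : w ≠ 0) (hw : w ≠ ∞)
    (a : ℝ≥0∞) : (a ^ (q - 1) / w) ^ (q / (q - 1)) * w = a ^ q * w ^ (-1 / (q - 1)) := by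
  have hq1 : 0 < q - 1 := by linarith
  rw [ENNReal.div_rpow_of_nonneg _ _ (by positivity), ← ENNReal.rpow_mul, mul_div_cancel₀ _ hq1.ne',
    div_eq_mul_inv, ← ENNReal.rpow_neg, mul_assoc]
  congr 1
  nth_rw 2 [← ENNReal.rpow_one w]
  rw [← ENNReal.rpow_add _ _ hw0 hw]
  congr 1
  field_simp
  ring

theorem div_rpow_mul_dual {q : ℝ} (hq : 1 < q) {w : ℝ≥0∞} (hw0 : w ≠ 0) (hw : w ≠ ∞)
    (a : ℝ≥0∞) :
    (a / w ^ (-1 / (q - 1))) ^ q * w ^ (-1 / (q - 1)) = a ^ q * w := by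
  have hq1 : 0 < q - 1 := by linarith
  rw [ENNReal.div_rpow_of_nonneg _ _ (by positivity), ← ENNReal.rpow_mul,
    div_eq_mul_inv, ← ENNReal.rpow_neg, mul_assoc, ← ENNReal.rpow_add _ _ hw0 hw]
  congr 1
  nth_rw 2 [← ENNReal.rpow_one w]
  congr 1
  field_simp
  ring

/-- The constant in Muckenhoupt's theorem. -/
noncomputable def muckenhouptConst (n : ℕ) (q : ℝ) (K : ℝ≥0∞) : ℝ≥0∞ :=
  (5 ^ n * (5 ^ n) ^ (q - 1) * K) ^ (q / (q - 1)) *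
    (ENNReal.ofReal (2 ^ (q / (q - 1)) * (q / (q - 1)) / (q / (q - 1) - 1)) *
      ENNReal.ofReal (2 ^ q * q / (q - 1)))

theorem muckenhouptConst_ne_top (n : ℕ) {q : ℝ} (hq : 1 < q) {K : ℝ≥0∞} (hK : K ≠ ∞) :
    muckenhouptConst n q K ≠ ∞ := by
  have hq1 : 0 < q - 1 := by linarith
  unfold muckenhouptConst
  refine ENNReal.mul_ne_top (ENNReal.rpow_ne_top_of_nonneg (by positivity)
    (ENNReal.mul_ne_top (ENNReal.mul_ne_top (by simp)
      (ENNReal.rpow_ne_top_of_nonneg hq1.le (by simp))) hK)) (by finiteness)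

/-- Muckenhoupt's theorem: the maximal operator is bounded on `L^q(w)` for `w ∈ A_q`. -/
theorem lintegral_cubeMaximal_rpow_mul_le {q : ℝ} (hq : 1 < q) {w σ : (Fin n → ℝ) → ℝ≥0∞}
    (hwm : Measurable w) (hw0 : ∀ x, w x ≠ 0) (hw : ∀ x, w x ≠ ∞)
    (hσ : ∀ x, σ x = w x ^ (-1 / (q - 1))) {K : ℝ≥0∞} (hKtop : K ≠ ∞)
    (hK : ∀ (y : Fin n → ℝ) (r : ℝ), 0 < r →
      (⨍⁻ x in closedBall y r, w x ∂volume) * (⨍⁻ x in closedBall y r, σ x ∂volume) ^ (q - 1) ≤ K)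
    {f : (Fin n → ℝ) → ℝ≥0∞} (hf : Measurable f) :
    ∫⁻ x, cubeMaximal f x ^ q * w x ≤ muckenhouptConst n q K * ∫⁻ x, f x ^ q * w x := by
  have hq1 : 0 < q - 1 := by linarith
  have hq' : 1 < q / (q - 1) := by rw [one_lt_div hq1]; linarith
  obtain rfl : σ = fun x => w x ^ (-1 / (q - 1)) := funext hσ
  set σ : (Fin n → ℝ) → ℝ≥0∞ := fun x => w x ^ (-1 / (q - 1)) with hσdef
  have hσm : Measurable σ := hwm.pow_const _
  have hσ0 : ∀ x, σ x ≠ 0 := fun x => by simp [hσdef, hw0 x, hw x]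
  have hσtop : ∀ x, σ x ≠ ∞ := fun x => by simp [hσdef, hw0 x, hw x]
  set W : Measure (Fin n → ℝ) := volume.withDensity w
  set S : Measure (Fin n → ℝ) := volume.withDensity σ
  set N : (Fin n → ℝ) → ℝ≥0∞ := enlargedMaximal S (fun x => f x / σ x) with hN
  have hNm : Measurable N := measurable_enlargedMaximal _ _
  set G : (Fin n → ℝ) → ℝ≥0∞ := fun x => N x ^ (q - 1) / w x with hG
  have hGm : Measurable G := (hNm.pow_const _).div hwm
  set c : ℝ≥0∞ := 5 ^ n with hc
  have hc0 : c ≠ 0 := by simp [hc]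
  have hctop : c ≠ ∞ := by simp [hc]
  have hfσ : Measurable fun x => f x / σ x := hf.div hσm
  -- The core estimate. Strong type `(q', q')` for `W` and `(q, q)` for `S` then give the theorem.
  have pointwise : ∀ x, cubeMaximal f x ^ (q - 1) ≤
      c * c ^ (q - 1) * K * enlargedMaximal W G x := by
    intro x
    rw [← ENNReal.le_rpow_inv_iff hq1]
    refine ballSup_le fun y r hx => ?_
    rw [ENNReal.le_rpow_inv_iff hq1]
    have hr := pos_of_mem_ball hx
    have h5r : 0 < 5 * r := by positivity
    set B := ball y r with hB
    set V := volume B with hV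
    have hV0 : V ≠ 0 := (measure_ball_pos _ _ hr).ne'
    have hVtop : V ≠ ∞ := measure_ball_lt_top.ne
    set a := ⨍⁻ x in closedBall y (5 * r), w x ∂volume with ha
    set b := ⨍⁻ x in closedBall y (5 * r), σ x ∂volume with hb
    have ha0 : a ≠ 0 := laverage_pos_of_pos hwm hw0 y h5r
    have hb0 : b ≠ 0 := laverage_pos_of_pos hσm hσ0 y h5r
    have hab : a * b ^ (q - 1) ≤ K := hK y _ h5r
    have hbq0 : b ^ (q - 1) ≠ 0 := (ENNReal.rpow_pos_of_nonneg (pos_iff_ne_zero.2 hb0) hq1.le).ne'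
    -- Both averages are nonzero and their `A_q` product is at most `K < ∞`, so both are finite and
    -- can be cancelled.
    have hatop : a ≠ ∞ := by
      rintro h
      rw [h, ENNReal.top_mul hbq0] at hab
      exact hKtop (top_le_iff.1 hab)
    have hbtop : b ≠ ∞ := by
      rintro h
      rw [h, ENNReal.top_rpow_of_pos hq1, ENNReal.mul_top ha0] at hab
      exact hKtop (top_le_iff.1 hab)
    have hvol : volume (closedBall y (5 * r)) = c * V := volume_closedBall_five_mul y hr
    have hWB : W (closedBall y (5 * r)) = c * V * a := by
      rw [withDensity_apply _ measurableSet_closedBall, ha, ← hvol]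
      exact (measure_mul_setLAverage _ measure_closedBall_lt_top.ne).symm
    have hSB : S (closedBall y (5 * r)) = c * V * b := by
      rw [withDensity_apply _ measurableSet_closedBall, hb, ← hvol]
      exact (measure_mul_setLAverage _ measure_closedBall_lt_top.ne).symm
    set I := ∫⁻ z in B, f z with hI
    have hIS : ∫⁻ z in B, f z / σ z ∂S = I := by
      rw [setLIntegral_withDensity_eq_setLIntegral_mul _ hσm hfσ measurableSet_ball]
      refine lintegral_congr fun z => ?_
      simp only [Pi.mul_apply]
      rw [ENNReal.mul_div_cancel (hσ0 z) (hσtop z)]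
    -- The ball `B` competes in the supremum defining `N z` for each of its points `z`, and `S(5B) =
    -- cVb`.
    have h1 : ∀ z ∈ B, I / (c * V * b) ≤ N z := by
      intro z hz
      rw [← hSB, ← hIS]
      exact le_ballSup (fun y r => (∫⁻ z in ball y r, f z / σ z ∂S) / S (closedBall y (5 * r))) hz
    have hGW : ∫⁻ z in B, G z ∂W = ∫⁻ z in B, N z ^ (q - 1) := by
      rw [setLIntegral_withDensity_eq_setLIntegral_mul _ hwm hGm measurableSet_ball]
      refine lintegral_congr fun z => ?_
      simp only [Pi.mul_apply, hG]
      rw [ENNReal.mul_div_cancel (hw0 z) (hw z)]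
    -- Integrate the previous bound over `B`; then `B` competes again, now at `x` and for the
    -- measure `W`.
    have h2 : (I / (c * V * b)) ^ (q - 1) * V ≤ c * V * a * enlargedMaximal W G x := by
      calc (I / (c * V * b)) ^ (q - 1) * V = ∫⁻ z in B, (I / (c * V * b)) ^ (q - 1) := by
            rw [setLIntegral_const]
        _ ≤ ∫⁻ z in B, N z ^ (q - 1) := by
            refine setLIntegral_mono' measurableSet_ball fun z hz => ?_
            exact ENNReal.rpow_le_rpow (h1 z hz) hq1.le
        _ = ∫⁻ z in B, G z ∂W := hGW.symm
        _ ≤ c * V * a * enlargedMaximal W G x := by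
            rw [mul_comm, ← ENNReal.div_le_iff
              (mul_ne_zero (mul_ne_zero hc0 hV0) ha0)
              (ENNReal.mul_ne_top (ENNReal.mul_ne_top hctop hVtop) hatop), ← hWB]
            exact le_ballSup (fun y r => (∫⁻ z in ball y r, G z ∂W) / W (closedBall y (5 * r))) hx
    have h3 : (I / (c * V * b)) ^ (q - 1) ≤ c * a * enlargedMaximal W G x := by
      rw [← ENNReal.mul_le_mul_iff_left hV0 hVtop]
      refine h2.trans_eq ?_
      ring
    have h4 : I / V = I / (c * V * b) * (c * b) := by
      rw [show c * V * b = c * b * V by ring, ENNReal.div_eq_inv_mul, ENNReal.div_eq_inv_mul,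
        ENNReal.mul_inv (Or.inr hVtop) (Or.inr hV0)]
      calc V⁻¹ * I = (c * b)⁻¹ * (c * b) * (V⁻¹ * I) := by
            rw [ENNReal.inv_mul_cancel (mul_ne_zero hc0 hb0) (ENNReal.mul_ne_top hctop hbtop),
              one_mul]
        _ = _ := by ring
    rw [setLAverage_eq, h4, ENNReal.mul_rpow_of_nonneg _ _ hq1.le,
      ENNReal.mul_rpow_of_nonneg _ _ hq1.le]
    calc (I / (c * V * b)) ^ (q - 1) * (c ^ (q - 1) * b ^ (q - 1))
        ≤ c * a * enlargedMaximal W G x * (c ^ (q - 1) * b ^ (q - 1)) := by gcongr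
      _ = c * c ^ (q - 1) * (a * b ^ (q - 1)) * enlargedMaximal W G x := by ring
      _ ≤ _ := by gcongr
  have hNG : Measurable fun x => enlargedMaximal W G x ^ (q / (q - 1)) :=
    (measurable_enlargedMaximal _ _).pow_const _
  calc ∫⁻ x, cubeMaximal f x ^ q * w x
      ≤ ∫⁻ x, (c * c ^ (q - 1) * K) ^ (q / (q - 1)) *
          (w x * enlargedMaximal W G x ^ (q / (q - 1))) := by
        refine lintegral_mono fun x => ?_
        have := ENNReal.rpow_le_rpow (pointwise x) (by positivity : 0 ≤ q / (q - 1))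
        rw [← ENNReal.rpow_mul, mul_div_cancel₀ _ hq1.ne',
          ENNReal.mul_rpow_of_nonneg _ _ (by positivity)] at this
        calc cubeMaximal f x ^ q * w x ≤ _ * w x := mul_le_mul' this le_rfl
          _ = _ := by ring
    _ = (c * c ^ (q - 1) * K) ^ (q / (q - 1)) *
          ∫⁻ x, enlargedMaximal W G x ^ (q / (q - 1)) ∂W := by
        rw [lintegral_const_mul (f := fun x => w x * enlargedMaximal W G x ^ (q / (q - 1))) _
            (hwm.mul hNG),
          lintegral_withDensity_eq_lintegral_mul _ hwm hNG]
        rfl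
    _ ≤ (c * c ^ (q - 1) * K) ^ (q / (q - 1)) *
        (ENNReal.ofReal (2 ^ (q / (q - 1)) * (q / (q - 1)) / (q / (q - 1) - 1)) *
          ∫⁻ x, G x ^ (q / (q - 1)) ∂W) := by
        exact mul_le_mul' le_rfl (lintegral_enlargedMaximal_rpow_le W hq' hGm)
    _ = (c * c ^ (q - 1) * K) ^ (q / (q - 1)) *
        (ENNReal.ofReal (2 ^ (q / (q - 1)) * (q / (q - 1)) / (q / (q - 1) - 1)) *
          ∫⁻ x, N x ^ q ∂S) := by
        congr 2
        rw [lintegral_withDensity_eq_lintegral_mul _ hwm (hGm.pow_const _),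
          lintegral_withDensity_eq_lintegral_mul _ hσm (hNm.pow_const _)]
        refine lintegral_congr fun x => ?_
        simp only [Pi.mul_apply]
        rw [mul_comm, mul_comm (σ x)]
        exact rpow_sub_one_div_rpow_mul hq (hw0 x) (hw x) _
    _ ≤ (c * c ^ (q - 1) * K) ^ (q / (q - 1)) *
        (ENNReal.ofReal (2 ^ (q / (q - 1)) * (q / (q - 1)) / (q / (q - 1) - 1)) *
          (ENNReal.ofReal (2 ^ q * q / (q - 1)) * ∫⁻ x, (f x / σ x) ^ q ∂S)) := by
        exact mul_le_mul' le_rfl (mul_le_mul' le_rfl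
          (lintegral_enlargedMaximal_rpow_le S hq (hf.div hσm)))
    _ = muckenhouptConst n q K * ∫⁻ x, f x ^ q * w x := by
        rw [muckenhouptConst, lintegral_withDensity_eq_lintegral_mul _ hσm (hfσ.pow_const q)]
        have : ∀ x, (σ * fun x => (f x / σ x) ^ q) x = f x ^ q * w x := by
          intro x
          simp only [Pi.mul_apply]
          rw [mul_comm]
          exact div_rpow_mul_dual hq (hw0 x) (hw x) _
        simp_rw [this]
        rw [← hc]
        ring

end Cubes

/-! ### Averages over cubes and the factorization of weights -/

section Averages
variable {n : ℕ}

theorem ball_ae_eq_closedBall_pi (y : Fin n → ℝ) {r : ℝ} (hr : 0 < r) :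
    (ball y r : Set (Fin n → ℝ)) =ᵐ[volume] closedBall y r := by
  refine ae_eq_of_subset_of_measure_ge ball_subset_closedBall ?_
    measurableSet_ball.nullMeasurableSet measure_closedBall_lt_top.ne
  rw [Real.volume_pi_closedBall _ hr.le, Real.volume_pi_ball _ hr]

/-- The metric on `Fin n → ℝ` is the sup metric, so the ball machinery is a theory of cubes. -/
theorem cube_eq_closedBall (a : Fin n → ℝ) {ℓ : ℝ} (hℓ : 0 < ℓ) :
    cube a ℓ = closedBall (fun i => a i + ℓ / 2) (ℓ / 2) := by
  ext x
  simp only [cube, mem_Icc, Pi.le_def, mem_closedBall, dist_pi_le_iff (by positivity : 0 ≤ ℓ / 2),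
    Real.dist_eq, abs_le]
  constructor
  · rintro ⟨h1, h2⟩ i
    constructor <;> linarith [h1 i, h2 i]
  · intro h
    constructor <;> intro i <;> linarith [(h i).1, (h i).2]

theorem closedBall_eq_cube (y : Fin n → ℝ) {r : ℝ} (hr : 0 < r) :
    closedBall y r = cube (fun i => y i - r) (2 * r) := by
  rw [cube_eq_closedBall _ (by positivity)]
  congr 1
  · ext i; ring
  · ring

/-- The normalized Lebesgue measure on a closed cube. -/
noncomputable abbrev cubeProb (y : Fin n → ℝ) (r : ℝ) : Measure (Fin n → ℝ) :=
  (volume.restrict (closedBall y r) univ)⁻¹ • volume.restrict (closedBall y r)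

theorem ae_cubeProb_of_ae_restrict {y : Fin n → ℝ} {r : ℝ}
    {P : (Fin n → ℝ) → Prop} (h : ∀ᵐ x ∂volume.restrict (closedBall y r), P x) :
    ∀ᵐ x ∂cubeProb y r, P x :=
  Measure.ae_smul_measure h _

theorem laverage_le_cubeMaximal (f : (Fin n → ℝ) → ℝ≥0∞) {x y : Fin n → ℝ} {r : ℝ}
    (hx : x ∈ ball y r) : ⨍⁻ z in closedBall y r, f z ∂volume ≤ cubeMaximal f x := by
  rw [← setLAverage_congr (ball_ae_eq_closedBall_pi y (pos_of_mem_ball hx))]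
  exact le_ballSup (fun y r => ⨍⁻ z in ball y r, f z ∂volume) hx

/-- Balls centred at `x` exhaust the space; if the maximal function vanished at `x`, so would the
integral over each. -/
theorem cubeMaximal_ne_zero {f : (Fin n → ℝ) → ℝ≥0∞} (hf : Measurable f)
    (h : ¬ f =ᵐ[volume] 0) (x : Fin n → ℝ) : cubeMaximal f x ≠ 0 := by
  intro h0
  apply h
  rw [← lintegral_eq_zero_iff hf, ← setLIntegral_univ, ← iUnion_ball_nat x,
    ← nonpos_iff_eq_zero]
  refine (lintegral_iUnion_le _ _).trans (le_of_eq ?_)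
  rw [ENNReal.tsum_eq_zero]
  intro k
  rcases Nat.eq_zero_or_pos k with rfl | hk
  · simp
  have hk : (0 : ℝ) < k := by exact_mod_cast hk
  have := le_ballSup (fun y r => ⨍⁻ z in ball y r, f z ∂volume) (mem_ball_self (x := x) hk)
  change _ ≤ cubeMaximal f x at this
  rw [h0, nonpos_iff_eq_zero, setLAverage_eq, ENNReal.div_eq_zero_iff] at this
  exact this.resolve_right measure_ball_lt_top.ne

/-- An `A_1` function in the sense `MF ≤ cF` that does not vanish identically is positive and has
positive and finite averages over cubes, which are bounded by `c` times the function. -/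
theorem average_of_cubeMaximal_le {F : (Fin n → ℝ) → ℝ≥0∞} (hF : Measurable F)
    (hF0 : ¬ F =ᵐ[volume] 0) (hFtop : ∀ᵐ x, F x ≠ ∞) {c : ℝ≥0∞} (hc : c ≠ ∞)
    (hM : ∀ x, cubeMaximal F x ≤ c * F x) :
    (∀ x, F x ≠ 0) ∧ ∀ (y : Fin n → ℝ) (r : ℝ), 0 < r →
      (⨍⁻ z in closedBall y r, F z ∂volume ≠ 0) ∧ (⨍⁻ z in closedBall y r, F z ∂volume ≠ ∞) ∧
      ∀ᵐ x ∂volume.restrict (closedBall y r),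
        ⨍⁻ z in closedBall y r, F z ∂volume ≤ F x * c := by
  have hpos : ∀ x, F x ≠ 0 := by
    intro x hx
    have := hM x
    rw [hx, mul_zero, nonpos_iff_eq_zero] at this
    exact cubeMaximal_ne_zero hF hF0 x this
  refine ⟨hpos, fun y r hr => ?_⟩
  have hae : ∀ᵐ x ∂volume.restrict (closedBall y r),
      ⨍⁻ z in closedBall y r, F z ∂volume ≤ F x * c := by
    have hball : ∀ᵐ x ∂volume.restrict (ball y r),
        ⨍⁻ z in closedBall y r, F z ∂volume ≤ F x * c := by
      filter_upwards [ae_restrict_mem measurableSet_ball] with x hx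
      rw [mul_comm]
      exact (laverage_le_cubeMaximal F hx).trans (hM x)
    rwa [Measure.restrict_congr_set (ball_ae_eq_closedBall_pi y hr)] at hball
  refine ⟨laverage_pos_of_pos hF hpos y hr, ?_, hae⟩
  -- On a set of positive measure some point satisfies both the `A_1` bound and `F x ≠ ∞`; it bounds
  -- the average.
  have : NeZero (volume.restrict (closedBall y r)) :=
    ⟨by rw [Ne, Measure.restrict_eq_zero]; exact (measure_closedBall_pos _ _ hr).ne'⟩
  obtain ⟨x, hx, hx'⟩ := (hae.and (ae_restrict_of_ae hFtop)).exists
  exact (hx.trans_lt (ENNReal.mul_lt_top hx'.lt_top hc.lt_top)).ne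

theorem ennreal_rpow_le_rpow_of_nonpos {x y : ℝ≥0∞} (h : x ≤ y) {z : ℝ} (hz : z ≤ 0) :
    y ^ z ≤ x ^ z := by
  rw [← neg_neg z, ENNReal.rpow_neg y, ENNReal.rpow_neg x, ENNReal.inv_le_inv]
  exact ENNReal.rpow_le_rpow h (by linarith)

/-- As `1 - p₀ ≤ 0`, the `A_1` lower bound for `F` by its average is an upper bound for `F^{1-p₀}`.
-/
theorem lintegral_factored_le {X : Type*} [MeasurableSpace X] {P : Measure X} {p₀ : ℝ}
    (hp₀ : 1 ≤ p₀) {F u : X → ℝ≥0∞} (hu : Measurable u)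
    {a c : ℝ≥0∞} (ha : ∀ᵐ x ∂P, a ≤ F x * c) :
    ∫⁻ x, F x ^ (1 - p₀) * u x ∂P ≤ (a / c) ^ (1 - p₀) * ∫⁻ x, u x ∂P := by
  rw [← lintegral_const_mul _ hu]
  refine lintegral_mono_ae ?_
  filter_upwards [ha] with x hx
  exact mul_le_mul' (ennreal_rpow_le_rpow_of_nonpos (ENNReal.div_le_of_le_mul hx)
    (by linarith)) le_rfl

/-- The dual exponent turns `F^{1-p₀}` into `F` and makes the power of `u` negative, so `F` and `u`
exchange roles: now the `A_1` bound for `u` is used. -/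
theorem lintegral_factored_dual_le {X : Type*} [MeasurableSpace X] {P : Measure X} {p₀ : ℝ}
    (hp₀ : 1 < p₀) {F u : X → ℝ≥0∞} (hF : Measurable F)
    (hF0 : ∀ᵐ x ∂P, F x ≠ 0) (hu0 : ∀ᵐ x ∂P, u x ≠ 0) (hFtop : ∀ᵐ x ∂P, F x ≠ ∞)
    {b c : ℝ≥0∞} (hb : ∀ᵐ x ∂P, b ≤ u x * c) :
    ∫⁻ x, (F x ^ (1 - p₀) * u x) ^ (-1 / (p₀ - 1)) ∂P ≤
      (∫⁻ x, F x ∂P) * (b / c) ^ (-1 / (p₀ - 1)) := by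
  have hp : 0 < p₀ - 1 := by linarith
  rw [← lintegral_mul_const _ hF]
  refine lintegral_mono_ae ?_
  filter_upwards [hF0, hFtop, hb, hu0] with x h0 htop hx hu
  have h1 : F x ^ (1 - p₀) ≠ 0 := by simp [h0, htop]
  rw [ENNReal.mul_rpow_of_ne_zero h1 hu, ← ENNReal.rpow_mul,
    show (1 - p₀) * (-1 / (p₀ - 1)) = 1 by field_simp; ring, ENNReal.rpow_one]
  refine mul_le_mul' le_rfl (ennreal_rpow_le_rpow_of_nonpos (ENNReal.div_le_of_le_mul hx) ?_)
  rw [neg_div]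
  exact neg_nonpos.2 (by positivity)

/-- The averages `a` of `F` and `b` of `u` cancel in the `A_{p₀}` product, leaving only the `A_1`
constants. -/
theorem factored_constant_eq {p₀ : ℝ} (hp₀ : 1 < p₀) {a b c₁ c₂ : ℝ≥0∞} (ha0 : a ≠ 0)
    (ha : a ≠ ∞) (hb0 : b ≠ 0) (hb : b ≠ ∞) (h₁0 : c₁ ≠ 0) (h₁ : c₁ ≠ ∞) (h₂0 : c₂ ≠ 0)
    (h₂ : c₂ ≠ ∞) :
    (a / c₁) ^ (1 - p₀) * b * (a * (b / c₂) ^ (-1 / (p₀ - 1))) ^ (p₀ - 1) =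
      c₁ ^ (p₀ - 1) * c₂ := by
  have hp : 0 < p₀ - 1 := by linarith
  have has0 : a ^ (p₀ - 1) ≠ 0 := (ENNReal.rpow_pos (pos_iff_ne_zero.2 ha0) ha).ne'
  have has : a ^ (p₀ - 1) ≠ ∞ := ENNReal.rpow_ne_top_of_nonneg hp.le ha
  have hc0 : c₁ ^ (p₀ - 1) ≠ 0 := (ENNReal.rpow_pos (pos_iff_ne_zero.2 h₁0) h₁).ne'
  have hc : c₁ ^ (p₀ - 1) ≠ ∞ := ENNReal.rpow_ne_top_of_nonneg hp.le h₁
  rw [ENNReal.mul_rpow_of_nonneg _ _ hp.le, ← ENNReal.rpow_mul, div_mul_cancel₀ _ hp.ne',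
    ENNReal.rpow_neg_one, ← neg_sub p₀ 1, ENNReal.rpow_neg, ENNReal.div_rpow_of_nonneg _ _ hp.le,
    ENNReal.inv_div (Or.inl hc) (Or.inl hc0), ENNReal.inv_div (Or.inl h₂) (Or.inl h₂0),
    div_eq_mul_inv, div_eq_mul_inv]
  calc _ = c₁ ^ (p₀ - 1) * c₂ * (a ^ (p₀ - 1) * (a ^ (p₀ - 1))⁻¹) * (b * b⁻¹) := by ring
    _ = _ := by
      rw [ENNReal.mul_inv_cancel has0 has, ENNReal.mul_inv_cancel hb0 hb, mul_one, mul_one]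

/-- The easy half of the factorization theorem: if `F` and `u` are `A_1` weights, then
`F^{1-p₀} u` is an `A_{p₀}` weight. -/
theorem isAp_factored {p₀ : ℝ} (hp₀ : 1 ≤ p₀) {F u : (Fin n → ℝ) → ℝ≥0∞}
    (hF : Measurable F) (hu : Measurable u) (hF0 : ¬ F =ᵐ[volume] 0) (hu0 : ¬ u =ᵐ[volume] 0)
    (hFtop : ∀ᵐ x, F x ≠ ∞) (hutop : ∀ᵐ x, u x ≠ ∞) {c₁ c₂ : ℝ≥0∞}
    (h₁0 : c₁ ≠ 0) (h₁ : c₁ ≠ ∞) (h₂0 : c₂ ≠ 0) (h₂ : c₂ ≠ ∞)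
    (hMF : ∀ x, cubeMaximal F x ≤ c₁ * F x) (hMu : ∀ x, cubeMaximal u x ≤ c₂ * u x) :
    IsAp p₀ (fun x => F x ^ (1 - p₀) * u x) ∧
      ApConst p₀ (fun x => F x ^ (1 - p₀) * u x) ≤ c₁ ^ (p₀ - 1) * c₂ := by
  obtain ⟨hFpos, hFavg⟩ := average_of_cubeMaximal_le hF hF0 hFtop h₁ hMF
  obtain ⟨hupos, huavg⟩ := average_of_cubeMaximal_le hu hu0 hutop h₂ hMu
  have hconst_top : c₁ ^ (p₀ - 1) * c₂ ≠ ∞ :=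
    ENNReal.mul_ne_top (ENNReal.rpow_ne_top_of_nonneg (by linarith) h₁) h₂
  have hWm : Measurable fun x => F x ^ (1 - p₀) * u x := (hF.pow_const _).mul hu
  have hWavg : ∀ (y : Fin n → ℝ) (r : ℝ), 0 < r →
      ⨍⁻ x in closedBall y r, F x ^ (1 - p₀) * u x ∂volume ≤
        ((⨍⁻ z in closedBall y r, F z ∂volume) / c₁) ^ (1 - p₀) *
          ⨍⁻ z in closedBall y r, u z ∂volume := fun y r hr =>
    lintegral_factored_le hp₀ hu (ae_cubeProb_of_ae_restrict (hFavg y r hr).2.2)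
  have hbound : ApConst p₀ (fun x => F x ^ (1 - p₀) * u x) ≤ c₁ ^ (p₀ - 1) * c₂ := by
    rcases hp₀.eq_or_lt with rfl | hp
    · simp only [ApConst, if_true, sub_self, ENNReal.rpow_zero, one_mul]
      refine iSup_le fun a => iSup_le fun ℓ => iSup_le fun hℓ => ?_
      rw [cube_eq_closedBall a hℓ]
      set y : Fin n → ℝ := fun i => a i + ℓ / 2
      obtain ⟨hb0, hb, hub⟩ := huavg y (ℓ / 2) (by positivity)
      set b := ⨍⁻ z in closedBall y (ℓ / 2), u z ∂volume
      have hess : essSup (fun x => (u x)⁻¹) (volume.restrict (closedBall y (ℓ / 2))) ≤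
          c₂ / b := by
        refine essSup_le_of_ae_le _ ?_
        filter_upwards [hub] with x hx
        rw [← ENNReal.inv_div (Or.inl h₂) (Or.inl h₂0), ENNReal.inv_le_inv]
        exact ENNReal.div_le_of_le_mul hx
      calc b * _ ≤ b * (c₂ / b) := by gcongr
        _ = c₂ := ENNReal.mul_div_cancel hb0 hb
    · rw [ApConst, if_neg hp.ne']
      refine iSup_le fun a => iSup_le fun ℓ => iSup_le fun hℓ => ?_
      rw [cube_eq_closedBall a hℓ]
      set y : Fin n → ℝ := fun i => a i + ℓ / 2
      have hr : 0 < ℓ / 2 := by positivity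
      obtain ⟨ha0, ha, hFa⟩ := hFavg y (ℓ / 2) hr
      obtain ⟨hb0, hb, hub⟩ := huavg y (ℓ / 2) hr
      have hdual := lintegral_factored_dual_le hp (P := cubeProb y (ℓ / 2)) hF
        (ae_of_all _ hFpos) (ae_of_all _ hupos)
        (ae_cubeProb_of_ae_restrict (ae_restrict_of_ae hFtop)) (ae_cubeProb_of_ae_restrict hub)
      rw [← factored_constant_eq hp ha0 ha hb0 hb h₁0 h₁ h₂0 h₂]
      exact mul_le_mul' (hWavg y _ hr) (ENNReal.rpow_le_rpow hdual (by linarith))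
  refine ⟨⟨⟨hWm.aemeasurable, ?_, ?_⟩, hbound.trans_lt hconst_top.lt_top⟩, hbound⟩
  · filter_upwards [hFtop] with x hx
    rw [pos_iff_ne_zero]
    exact mul_ne_zero (ENNReal.rpow_pos (pos_iff_ne_zero.2 (hFpos x)) hx).ne' (hupos x)
  · intro K hK
    obtain ⟨r, hr, hKr⟩ := hK.isBounded.subset_closedBall_lt 0 0
    obtain ⟨ha0, ha, -⟩ := hFavg 0 r hr
    obtain ⟨-, hb, -⟩ := huavg 0 r hr
    refine (lintegral_mono_set hKr).trans_lt ?_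
    rw [← measure_mul_setLAverage _ measure_closedBall_lt_top.ne]
    refine ENNReal.mul_lt_top measure_closedBall_lt_top ((hWavg 0 r hr).trans_lt ?_)
    refine ENNReal.mul_lt_top ?_ hb.lt_top
    rw [← neg_sub p₀ 1, ENNReal.rpow_neg, ENNReal.inv_lt_top]
    exact ENNReal.rpow_pos (ENNReal.div_pos ha0 h₁) (ENNReal.div_ne_top ha h₁0)

end Averages

/-! ### The Rubio de Francia algorithm -/

section RubioDeFrancia
variable {n : ℕ}

theorem laverage_tsum_const_mul {X : Type*} [MeasurableSpace X] {μ : Measure X}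
    (c : ℕ → ℝ≥0∞) {h : ℕ → X → ℝ≥0∞} (hh : ∀ k, Measurable (h k)) :
    ⨍⁻ x, ∑' k, c k * h k x ∂μ = ∑' k, c k * ⨍⁻ x, h k x ∂μ := by
  simp only [laverage]
  rw [lintegral_tsum fun k => ((hh k).const_mul _).aemeasurable]
  exact tsum_congr fun k => lintegral_const_mul _ (hh k)

theorem cubeMaximal_tsum_const_mul_le (c : ℕ → ℝ≥0∞) {h : ℕ → (Fin n → ℝ) → ℝ≥0∞}
    (hh : ∀ k, Measurable (h k)) (x : Fin n → ℝ) :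
    cubeMaximal (fun x => ∑' k, c k * h k x) x ≤ ∑' k, c k * cubeMaximal (h k) x := by
  refine ballSup_le fun y r hx => ?_
  rw [laverage_tsum_const_mul c hh]
  gcongr with k
  exact le_ballSup (fun y r => ⨍⁻ z in ball y r, h k z ∂volume) hx

/-- The Rubio de Francia algorithm. -/
theorem exists_rubioDeFrancia_majorant {q : ℝ} (hq : 1 ≤ q) {μ : Measure (Fin n → ℝ)}
    {A : ℝ≥0∞} (hA0 : A ≠ 0) (hA : A ≠ ∞)
    (hM : ∀ f : (Fin n → ℝ) → ℝ≥0∞, Measurable f →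
      (∫⁻ x, cubeMaximal f x ^ q ∂μ) ^ (1 / q) ≤ A * (∫⁻ x, f x ^ q ∂μ) ^ (1 / q))
    {f : (Fin n → ℝ) → ℝ≥0∞} (hf : Measurable f) :
    ∃ F : (Fin n → ℝ) → ℝ≥0∞, Measurable F ∧ (∀ x, f x ≤ F x) ∧
      (∫⁻ x, F x ^ q ∂μ) ^ (1 / q) ≤ 2 * (∫⁻ x, f x ^ q ∂μ) ^ (1 / q) ∧
      ∀ x, cubeMaximal F x ≤ 2 * A * F x := by
  have hq0 : 0 < q := by linarith
  have h2A0 : 2 * A ≠ 0 := mul_ne_zero two_ne_zero hA0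
  have h2A : 2 * A ≠ ∞ := ENNReal.mul_ne_top (by simp) hA
  set h : ℕ → (Fin n → ℝ) → ℝ≥0∞ := fun k => cubeMaximal^[k] f with hh
  have hsucc : ∀ k, h (k + 1) = cubeMaximal (h k) := fun k => Function.iterate_succ_apply' _ _ _
  have hm : ∀ k, Measurable (h k) := by
    intro k
    cases k with
    | zero => exact hf
    | succ k => rw [hsucc]; exact measurable_cubeMaximal _
  -- The majorant is `∑ (2A)^{-k} M^k f`. Its terms have norm at most `2^{-k}‖f‖`, and `M` shifts
  -- the series by one index at the cost of a factor `2A`.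
  set c : ℕ → ℝ≥0∞ := fun k => ((2 * A)⁻¹) ^ k with hc
  set R := (∫⁻ x, f x ^ q ∂μ) ^ (1 / q) with hR
  have hnorm : ∀ k, (∫⁻ x, h k x ^ q ∂μ) ^ (1 / q) ≤ A ^ k * R := by
    intro k
    induction k with
    | zero => simp [hh, hR]
    | succ k ih =>
      rw [hsucc]
      calc _ ≤ A * (∫⁻ x, h k x ^ q ∂μ) ^ (1 / q) := hM _ (hm k)
        _ ≤ A * (A ^ k * R) := by gcongr
        _ = _ := by ring
  have hterm : ∀ k, (∫⁻ x, (c k * h k x) ^ q ∂μ) ^ (1 / q) ≤ 2⁻¹ ^ k * R := by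
    intro k
    simp_rw [ENNReal.mul_rpow_of_nonneg _ _ hq0.le]
    rw [lintegral_const_mul _ ((hm k).pow_const _), ENNReal.mul_rpow_of_nonneg _ _ (by positivity),
      ← ENNReal.rpow_mul, mul_one_div_cancel hq0.ne', ENNReal.rpow_one]
    calc c k * _ ≤ c k * (A ^ k * R) := by gcongr; exact hnorm k
      _ = (2⁻¹ * (A⁻¹ * A)) ^ k * R := by
        rw [hc]
        simp only
        rw [ENNReal.mul_inv (by simp) (by simp), ← mul_assoc, ← mul_pow, mul_assoc]
      _ = 2⁻¹ ^ k * R := by rw [ENNReal.inv_mul_cancel hA0 hA, mul_one]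
  -- Minkowski is applied to partial sums; monotone convergence passes to the series.
  set s : ℕ → (Fin n → ℝ) → ℝ≥0∞ := fun N x => ∑ k ∈ Finset.range N, c k * h k x with hs
  have hsm : ∀ N, Measurable (s N) := fun N =>
    Finset.measurable_fun_sum _ fun k _ => (hm k).const_mul _
  have hpartial : ∀ N, (∫⁻ x, s N x ^ q ∂μ) ^ (1 / q) ≤ ∑ k ∈ Finset.range N, 2⁻¹ ^ k * R := by
    intro N
    induction N with
    | zero => simp [hs, hq0]
    | succ N ih =>
      have e : ∀ x, s (N + 1) x = (s N + fun x => c N * h N x) x := fun x => by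
        simp [hs, Finset.sum_range_succ]
      simp_rw [e]
      rw [Finset.sum_range_succ]
      exact (ENNReal.lintegral_Lp_add_le (hsm N).aemeasurable
        ((hm N).const_mul _).aemeasurable hq).trans (add_le_add ih (hterm N))
  refine ⟨fun x => ∑' k, c k * h k x, Measurable.tsum fun k => (hm k).const_mul _,
    fun x => ?_, ?_, fun x => ?_⟩
  · refine le_trans (le_of_eq ?_) (ENNReal.le_tsum 0)
    simp [hc, hh]
  · rw [one_div, ENNReal.rpow_inv_le_iff hq0]
    have hmono : Monotone fun N x => s N x ^ q := by
      intro M N hMN x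
      refine ENNReal.rpow_le_rpow ?_ hq0.le
      exact Finset.sum_le_sum_of_subset (Finset.range_mono hMN)
    have e : ∀ x, (∑' k, c k * h k x) ^ q = ⨆ N, s N x ^ q := by
      intro x
      rw [ENNReal.tsum_eq_iSup_nat]
      exact (ENNReal.orderIsoRpow q hq0).map_iSup _
    simp_rw [e]
    rw [lintegral_iSup (fun N => (hsm N).pow_const _) hmono]
    refine iSup_le fun N => ?_
    rw [← ENNReal.rpow_inv_le_iff hq0, ← one_div]
    refine (hpartial N).trans ?_
    rw [← Finset.sum_mul]
    gcongr
    refine (ENNReal.sum_le_tsum _).trans (le_of_eq ?_)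
    rw [ENNReal.tsum_geometric, ENNReal.one_sub_inv_two, inv_inv]
  · refine (cubeMaximal_tsum_const_mul_le c hm x).trans ?_
    calc ∑' k, c k * cubeMaximal (h k) x = ∑' k, 2 * A * (c (k + 1) * h (k + 1) x) := by
          refine tsum_congr fun k => ?_
          rw [hsucc, hc]
          simp only
          rw [pow_succ, ← mul_assoc, ← mul_assoc, mul_comm (2 * A), mul_assoc (_ ^ k),
            ENNReal.mul_inv_cancel h2A0 h2A, mul_one]
      _ = 2 * A * ∑' k, c (k + 1) * h (k + 1) x := ENNReal.tsum_mul_left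
      _ ≤ 2 * A * ∑' k, c k * h k x := by
          exact mul_le_mul' le_rfl (ENNReal.tsum_comp_le_tsum_of_injective (add_left_injective 1)
            fun k => c k * h k x)

end RubioDeFrancia

/-! ### Extrapolation on a single set -/

section Extrapolation
variable {n : ℕ}

theorem laverage_mul_laverage_le_ApConst {p : ℝ} (hp : 1 < p) (w : (Fin n → ℝ) → ℝ≥0∞)
    (y : Fin n → ℝ) {r : ℝ} (hr : 0 < r) :
    (⨍⁻ x in closedBall y r, w x ∂volume) *
      (⨍⁻ x in closedBall y r, w x ^ (-1 / (p - 1)) ∂volume) ^ (p - 1) ≤ ApConst p w := by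
  rw [ApConst, if_neg hp.ne', closedBall_eq_cube y hr]
  exact le_iSup_of_le _ (le_iSup_of_le (2 * r) (le_iSup_of_le (by positivity) le_rfl))

/-- A nonzero bound for the norm of the maximal operator on `L^q(w)` when `‖w‖_{A_q} ≤ K`. -/
noncomputable def maximalNormBound (n : ℕ) (q : ℝ) (K : ℝ≥0∞) : ℝ≥0∞ :=
  1 + muckenhouptConst n q K ^ (1 / q)

theorem maximalNormBound_ne_zero (n : ℕ) (q : ℝ) (K : ℝ≥0∞) : maximalNormBound n q K ≠ 0 := by
  simp [maximalNormBound]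

theorem maximalNormBound_ne_top (n : ℕ) {q : ℝ} (hq : 1 < q) {K : ℝ≥0∞} (hK : K ≠ ∞) :
    maximalNormBound n q K ≠ ∞ :=
  ENNReal.add_ne_top.2 ⟨ENNReal.one_ne_top,
    ENNReal.rpow_ne_top_of_nonneg (by positivity) (muckenhouptConst_ne_top n hq hK)⟩

/-- Rubio de Francia majorants in `L^q(w)` for a Muckenhoupt weight `w`. -/
theorem exists_majorant_of_muckenhoupt {q : ℝ} (hq : 1 < q) {w σ : (Fin n → ℝ) → ℝ≥0∞}
    (hwm : Measurable w) (hw0 : ∀ x, w x ≠ 0) (hw : ∀ x, w x ≠ ∞)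
    (hσ : ∀ x, σ x = w x ^ (-1 / (q - 1))) {K : ℝ≥0∞} (hKtop : K ≠ ∞)
    (hK : ∀ (y : Fin n → ℝ) (r : ℝ), 0 < r →
      (⨍⁻ x in closedBall y r, w x ∂volume) * (⨍⁻ x in closedBall y r, σ x ∂volume) ^ (q - 1) ≤ K)
    {f : (Fin n → ℝ) → ℝ≥0∞} (hf : Measurable f) (hfq : ∫⁻ x, f x ^ q * w x ≠ ∞) :
    ∃ F : (Fin n → ℝ) → ℝ≥0∞, Measurable F ∧ (∀ x, f x ≤ F x) ∧
      (∫⁻ x, F x ^ q * w x) ^ (1 / q) ≤ 2 * (∫⁻ x, f x ^ q * w x) ^ (1 / q) ∧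
      (∀ᵐ x, F x ≠ ∞) ∧ ∀ x, cubeMaximal F x ≤ 2 * maximalNormBound n q K * F x := by
  have hq0 : 0 < q := by linarith
  have hconv : ∀ h : (Fin n → ℝ) → ℝ≥0∞, Measurable h →
      ∫⁻ x, h x ^ q ∂(volume.withDensity w) = ∫⁻ x, h x ^ q * w x := by
    intro h hh
    rw [lintegral_withDensity_eq_lintegral_mul _ hwm (hh.pow_const q)]
    exact lintegral_congr fun x => mul_comm _ _
  obtain ⟨F, hF, hfF, hnorm, hMF⟩ := exists_rubioDeFrancia_majorant hq.le
    (μ := volume.withDensity w) (maximalNormBound_ne_zero n q K)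
    (maximalNormBound_ne_top n hq hKtop) (fun h hh => by
      rw [hconv h hh, hconv _ (measurable_cubeMaximal h)]
      calc (∫⁻ x, cubeMaximal h x ^ q * w x) ^ (1 / q)
          ≤ (muckenhouptConst n q K * ∫⁻ x, h x ^ q * w x) ^ (1 / q) :=
            ENNReal.rpow_le_rpow
              (lintegral_cubeMaximal_rpow_mul_le hq hwm hw0 hw hσ hKtop hK hh) (by positivity)
        _ = muckenhouptConst n q K ^ (1 / q) * (∫⁻ x, h x ^ q * w x) ^ (1 / q) :=
            ENNReal.mul_rpow_of_nonneg _ _ (by positivity)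
        _ ≤ _ := mul_le_mul' le_add_self le_rfl) hf
  rw [hconv F hF, hconv f hf] at hnorm
  refine ⟨F, hF, hfF, hnorm, ?_, hMF⟩
  have hfin : ∫⁻ x, F x ^ q * w x ≠ ∞ := by
    intro h
    rw [h, ENNReal.top_rpow_of_pos (by positivity), top_le_iff] at hnorm
    exact ENNReal.mul_ne_top (by simp) (ENNReal.rpow_ne_top_of_nonneg (by positivity) hfq) hnorm
  filter_upwards [ae_lt_top ((hF.pow_const q).mul hwm) hfin] with x hx hFx
  replace hx : F x ^ q * w x < ∞ := hx
  rw [hFx, ENNReal.top_rpow_of_pos hq0, ENNReal.top_mul (hw0 x)] at hx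
  exact absurd hx (lt_irrefl _)

/-- A bound for the `A_{p₀}` constant of the weights used in the extrapolation. -/
noncomputable def extrapolationWeightBound (n : ℕ) (p₀ p : ℝ) (K : ℝ≥0∞) : ℝ≥0∞ :=
  (2 * maximalNormBound n p K) ^ (p₀ - 1) *
    (2 * maximalNormBound n (p / (p - 1)) (K ^ (1 / (p - 1))))

theorem extrapolationWeightBound_ne_top (n : ℕ) {p₀ p : ℝ} (hp₀ : 1 ≤ p₀) (hp : 1 < p)
    {K : ℝ≥0∞} (hK : K ≠ ∞) : extrapolationWeightBound n p₀ p K ≠ ∞ := by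
  have hp1 : 0 < p - 1 := by linarith
  have hp' : 1 < p / (p - 1) := by rw [one_lt_div hp1]; linarith
  exact ENNReal.mul_ne_top
    (ENNReal.rpow_ne_top_of_nonneg (by linarith)
      (ENNReal.mul_ne_top (by simp) (maximalNormBound_ne_top n hp hK)))
    (ENNReal.mul_ne_top (by simp) (maximalNormBound_ne_top n hp'
      (ENNReal.rpow_ne_top_of_nonneg (by positivity) hK)))

/-- On `E` write `U = (F^{1-p₀}U)^{1/p₀} (FU)^{1-1/p₀}` and use Hölder; on the right, `f ≤ F` gives
`f^{p₀}F^{1-p₀}U ≤ FU`. The powers `1/p₀` and `1 - 1/p₀` of `∫FU` then recombine. The form of Hölder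
used allows the exponent `0`, so `p₀ = 1` is included. -/
theorem mul_lintegral_le_of_factored {X : Type*} [MeasurableSpace X] {μ : Measure X} {p₀ : ℝ}
    (hp₀ : 1 ≤ p₀) {f F U : X → ℝ≥0∞} (hF : Measurable F) (hU : Measurable U)
    (hF0 : ∀ᵐ x ∂μ, F x ≠ 0) (hFtop : ∀ᵐ x ∂μ, F x ≠ ∞) (hfF : ∀ x, f x ≤ F x)
    {E : Set X} {y Φ : ℝ≥0∞}
    (h : y * (∫⁻ x in E, F x ^ (1 - p₀) * U x ∂μ) ^ (1 / p₀) ≤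
      Φ * (∫⁻ x, f x ^ p₀ * (F x ^ (1 - p₀) * U x) ∂μ) ^ (1 / p₀)) :
    y * ∫⁻ x in E, U x ∂μ ≤ Φ * ∫⁻ x, F x * U x ∂μ := by
  have hp : 0 < p₀ := by linarith
  have hs : 0 ≤ 1 / p₀ := by positivity
  have hs' : 0 ≤ 1 - 1 / p₀ := by
    rw [sub_nonneg, div_le_one hp]; exact hp₀
  set J := ∫⁻ x, F x * U x ∂μ
  have hadd : ∀ a : ℝ≥0∞, a ^ (1 / p₀) * a ^ (1 - 1 / p₀) = a := fun a => by
    rw [← ENNReal.rpow_add_of_nonneg _ _ hs hs', add_sub_cancel, ENNReal.rpow_one]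
  have h1 : ∫⁻ x in E, U x ∂μ ≤
      (∫⁻ x in E, F x ^ (1 - p₀) * U x ∂μ) ^ (1 / p₀) * J ^ (1 - 1 / p₀) := by
    calc ∫⁻ x in E, U x ∂μ
        ≤ ∫⁻ x in E, (F x ^ (1 - p₀) * U x) ^ (1 / p₀) * (F x * U x) ^ (1 - 1 / p₀) ∂μ := by
          refine lintegral_mono_ae ?_
          filter_upwards [ae_restrict_of_ae hF0, ae_restrict_of_ae hFtop] with x h0 htop
          refine le_of_eq ?_
          rw [ENNReal.mul_rpow_of_nonneg _ _ hs, ENNReal.mul_rpow_of_nonneg _ _ hs',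
            mul_mul_mul_comm, hadd, ← ENNReal.rpow_mul, ← ENNReal.rpow_add _ _ h0 htop,
            show (1 - p₀) * (1 / p₀) + (1 - 1 / p₀) = 0 by field_simp; ring, ENNReal.rpow_zero,
            one_mul]
      _ ≤ (∫⁻ x in E, F x ^ (1 - p₀) * U x ∂μ) ^ (1 / p₀) *
            (∫⁻ x in E, F x * U x ∂μ) ^ (1 - 1 / p₀) :=
          ENNReal.lintegral_mul_norm_pow_le ((hF.pow_const _).mul hU).aemeasurable
            (hF.mul hU).aemeasurable hs hs' (by ring)
      _ ≤ _ := mul_le_mul' le_rfl (ENNReal.rpow_le_rpow (setLIntegral_le_lintegral _ _) hs')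
  have h2 : ∫⁻ x, f x ^ p₀ * (F x ^ (1 - p₀) * U x) ∂μ ≤ J := by
    refine lintegral_mono_ae ?_
    filter_upwards [hF0, hFtop] with x h0 htop
    calc f x ^ p₀ * (F x ^ (1 - p₀) * U x) ≤ F x ^ p₀ * (F x ^ (1 - p₀) * U x) :=
          mul_le_mul' (ENNReal.rpow_le_rpow (hfF x) hp.le) le_rfl
      _ = F x * U x := by
          rw [← mul_assoc, ← ENNReal.rpow_add _ _ h0 htop, add_sub_cancel, ENNReal.rpow_one]
  calc y * ∫⁻ x in E, U x ∂μ
      ≤ y * ((∫⁻ x in E, F x ^ (1 - p₀) * U x ∂μ) ^ (1 / p₀) * J ^ (1 - 1 / p₀)) :=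
        mul_le_mul' le_rfl h1
    _ = y * (∫⁻ x in E, F x ^ (1 - p₀) * U x ∂μ) ^ (1 / p₀) * J ^ (1 - 1 / p₀) :=
        (mul_assoc _ _ _).symm
    _ ≤ Φ * J ^ (1 / p₀) * J ^ (1 - 1 / p₀) :=
        mul_le_mul' (h.trans (mul_le_mul' le_rfl (ENNReal.rpow_le_rpow h2 hs))) le_rfl
    _ = Φ * J := by rw [mul_assoc, hadd]

/-- Weighted duality: Hölder's inequality between `L^p(w)` and `L^{p'}(w^{-1/(p-1)})`. -/
theorem lintegral_mul_le_weighted {X : Type*} [MeasurableSpace X] {μ : Measure X} {p : ℝ}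
    (hp : 1 < p) {F U w : X → ℝ≥0∞} (hF : Measurable F) (hU : Measurable U) (hw : Measurable w)
    (hw0 : ∀ x, w x ≠ 0) (hwtop : ∀ x, w x ≠ ∞) :
    ∫⁻ x, F x * U x ∂μ ≤ (∫⁻ x, F x ^ p * w x ∂μ) ^ (1 / p) *
      (∫⁻ x, U x ^ (p / (p - 1)) * w x ^ (-1 / (p - 1)) ∂μ) ^ (1 / (p / (p - 1))) := by
  have hp0 : 0 < p := by linarith
  have hp1 : 0 < p - 1 := by linarith
  have hconj : p.HolderConjugate (p / (p - 1)) := Real.HolderConjugate.conjExponent hp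
  have hl := ENNReal.lintegral_mul_le_Lp_mul_Lq μ hconj
    (hF.mul (hw.pow_const (1 / p))).aemeasurable (hU.mul (hw.pow_const (-(1 / p)))).aemeasurable
  have e1 : ∀ x, ((fun x => F x * w x ^ (1 / p)) * fun x => U x * w x ^ (-(1 / p))) x =
      F x * U x := fun x => by
    simp only [Pi.mul_apply]
    rw [mul_mul_mul_comm, ← ENNReal.rpow_add _ _ (hw0 x) (hwtop x), add_neg_cancel,
      ENNReal.rpow_zero, mul_one]
  have e2 : ∀ x, (F x * w x ^ (1 / p)) ^ p = F x ^ p * w x := fun x => by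
    rw [ENNReal.mul_rpow_of_nonneg _ _ hp0.le, ← ENNReal.rpow_mul, one_div_mul_cancel hp0.ne',
      ENNReal.rpow_one]
  have e3 : ∀ x, (U x * w x ^ (-(1 / p))) ^ (p / (p - 1)) =
      U x ^ (p / (p - 1)) * w x ^ (-1 / (p - 1)) := fun x => by
    rw [ENNReal.mul_rpow_of_nonneg _ _ (by positivity), ← ENNReal.rpow_mul]
    congr 2
    field_simp
  simp only [e2, e3, Pi.mul_apply] at hl
  refine le_trans (le_of_eq ?_) hl
  exact lintegral_congr fun x => (e1 x).symm

/-- Extrapolation for the weighted measure of a single set. -/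
theorem extrapolation_of_set {p₀ p : ℝ} (hp₀ : 1 ≤ p₀) (hp : 1 < p)
    {w : (Fin n → ℝ) → ℝ≥0∞} (hwm : Measurable w) (hw0 : ∀ x, w x ≠ 0) (hw : ∀ x, w x ≠ ∞)
    (hK : ApConst p w ≠ ∞) {f : (Fin n → ℝ) → ℝ≥0∞} (hf : Measurable f)
    (hf0 : ¬ f =ᵐ[volume] 0) (hftop : ∫⁻ x, f x ^ p * w x ≠ ∞)
    {E : Set (Fin n → ℝ)} (hE : MeasurableSet E) (hEtop : ∫⁻ x in E, w x ≠ ∞) {y Φ : ℝ≥0∞}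
    (h : ∀ W : (Fin n → ℝ) → ℝ≥0∞, IsAp p₀ W →
      ApConst p₀ W ≤ extrapolationWeightBound n p₀ p (ApConst p w) →
      y * (∫⁻ x in E, W x) ^ (1 / p₀) ≤ Φ * (∫⁻ x, f x ^ p₀ * W x) ^ (1 / p₀)) :
    y * (∫⁻ x in E, w x) ^ (1 / p) ≤ 4 * Φ * (∫⁻ x, f x ^ p * w x) ^ (1 / p) := by
  have hp0 : 0 < p := by linarith
  have hp1 : 0 < p - 1 := by linarith
  have hp' : 1 < p / (p - 1) := by rw [one_lt_div hp1]; linarith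
  have hp'0 : 0 < p / (p - 1) := by linarith
  by_cases hE0 : ∫⁻ x in E, w x = 0
  · rw [hE0, ENNReal.zero_rpow_of_pos (by positivity), mul_zero]
    exact zero_le
  set K := ApConst p w with hKdef
  set σ : (Fin n → ℝ) → ℝ≥0∞ := fun x => w x ^ (-1 / (p - 1)) with hσ
  have hσm : Measurable σ := hwm.pow_const _
  -- Duality is symmetric: `w` is the dual weight of `σ` for the exponent `p'`, so the same majorant
  -- lemma serves both sides.
  have hwσ : ∀ x, w x = σ x ^ (-1 / (p / (p - 1) - 1)) := fun x => by
    rw [hσ]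
    simp only
    rw [← ENNReal.rpow_mul, show -1 / (p - 1) * (-1 / (p / (p - 1) - 1)) = 1 by
      rw [show p / (p - 1) - 1 = 1 / (p - 1) by field_simp; ring]
      field_simp, ENNReal.rpow_one]
  have hσ0 : ∀ x, σ x ≠ 0 := fun x => by simp [hσ, hw0 x, hw x]
  have hσtop : ∀ x, σ x ≠ ∞ := fun x => by simp [hσ, hw0 x, hw x]
  have hKw : ∀ (y : Fin n → ℝ) (r : ℝ), 0 < r → (⨍⁻ x in closedBall y r, w x ∂volume) *
      (⨍⁻ x in closedBall y r, σ x ∂volume) ^ (p - 1) ≤ K := fun y r hr =>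
    laverage_mul_laverage_le_ApConst hp w y hr
  have hKσ : ∀ (y : Fin n → ℝ) (r : ℝ), 0 < r → (⨍⁻ x in closedBall y r, σ x ∂volume) *
      (⨍⁻ x in closedBall y r, w x ∂volume) ^ (p / (p - 1) - 1) ≤ K ^ (1 / (p - 1)) := by
    intro y r hr
    refine le_trans (le_of_eq ?_) (ENNReal.rpow_le_rpow (hKw y r hr) (by positivity))
    rw [ENNReal.mul_rpow_of_nonneg _ _ (by positivity), ← ENNReal.rpow_mul,
      mul_one_div_cancel hp1.ne', ENNReal.rpow_one, mul_comm,
      show p / (p - 1) - 1 = 1 / (p - 1) by field_simp; ring]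
  -- Since `w^{p'}σ = w`, the norm of `1_E w` in `L^{p'}(σ)` is `w(E)^{1/p'}`.
  have hstart : ∫⁻ x, E.indicator w x ^ (p / (p - 1)) * σ x = ∫⁻ x in E, w x := by
    rw [← lintegral_indicator hE]
    refine lintegral_congr fun x => ?_
    by_cases hx : x ∈ E
    · simp only [indicator_of_mem hx, hσ]
      rw [← ENNReal.rpow_add _ _ (hw0 x) (hw x),
        show p / (p - 1) + -1 / (p - 1) = 1 by field_simp; ring, ENNReal.rpow_one]
    · simp [indicator_of_notMem hx, hp'0]
  obtain ⟨F, hF, hfF, hFnorm, hFtop, hMF⟩ :=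
    exists_majorant_of_muckenhoupt hp hwm hw0 hw (fun _ => rfl) hK hKw hf hftop
  obtain ⟨U, hU, hwU, hUnorm, hUtop, hMU⟩ :=
    exists_majorant_of_muckenhoupt hp' hσm hσ0 hσtop hwσ
      (ENNReal.rpow_ne_top_of_nonneg (by positivity) hK) hKσ (hwm.indicator hE)
      (by rw [hstart]; exact hEtop)
  rw [hstart] at hUnorm
  have hF0 : ¬ F =ᵐ[volume] 0 := by
    intro h0
    apply hf0
    filter_upwards [h0] with x hx
    exact nonpos_iff_eq_zero.1 ((hfF x).trans_eq hx)
  have hU0 : ¬ U =ᵐ[volume] 0 := by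
    intro h0
    apply hE0
    rw [← lintegral_indicator hE, lintegral_eq_zero_iff (hwm.indicator hE)]
    filter_upwards [h0] with x hx
    exact nonpos_iff_eq_zero.1 ((hwU x).trans_eq hx)
  have h₁0 : 2 * maximalNormBound n p K ≠ 0 :=
    mul_ne_zero two_ne_zero (maximalNormBound_ne_zero _ _ _)
  have h₁ : 2 * maximalNormBound n p K ≠ ∞ :=
    ENNReal.mul_ne_top (by simp) (maximalNormBound_ne_top n hp hK)
  have h₂0 : 2 * maximalNormBound n (p / (p - 1)) (K ^ (1 / (p - 1))) ≠ 0 :=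
    mul_ne_zero two_ne_zero (maximalNormBound_ne_zero _ _ _)
  have h₂ : 2 * maximalNormBound n (p / (p - 1)) (K ^ (1 / (p - 1))) ≠ ∞ :=
    ENNReal.mul_ne_top (by simp) (maximalNormBound_ne_top n hp'
      (ENNReal.rpow_ne_top_of_nonneg (by positivity) hK))
  have hFpos := (average_of_cubeMaximal_le hF hF0 hFtop h₁ hMF).1
  obtain ⟨hAp, hApC⟩ := isAp_factored hp₀ hF hU hF0 hU0 hFtop hUtop h₁0 h₁ h₂0 h₂ hMF hMU
  have hkey := mul_lintegral_le_of_factored hp₀ hF hU (ae_of_all _ hFpos) hFtop hfF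
    (h _ hAp hApC)
  set ω := ∫⁻ x in E, w x with hω
  set R := (∫⁻ x, f x ^ p * w x) ^ (1 / p)
  have hωU : ω ≤ ∫⁻ x in E, U x :=
    setLIntegral_mono' hE fun x hx => by simpa [indicator_of_mem hx] using hwU x
  have hchain : y * ω ≤ 4 * Φ * R * ω ^ (1 / (p / (p - 1))) := by
    calc y * ω ≤ y * ∫⁻ x in E, U x := mul_le_mul' le_rfl hωU
      _ ≤ Φ * ∫⁻ x, F x * U x := hkey
      _ ≤ Φ * ((2 * R) * (2 * ω ^ (1 / (p / (p - 1))))) :=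
          mul_le_mul' le_rfl ((lintegral_mul_le_weighted hp hF hU hwm hw0 hw).trans
            (mul_le_mul' hFnorm hUnorm))
      _ = _ := by ring
  have hs0 : ω ^ (1 / (p / (p - 1))) ≠ 0 := (ENNReal.rpow_pos (pos_iff_ne_zero.2 hE0) hEtop).ne'
  have hs_fin : ω ^ (1 / (p / (p - 1))) ≠ ∞ :=
    ENNReal.rpow_ne_top_of_nonneg (by positivity) hEtop
  -- Cancelling `w(E)^{1/p'}` is where `0 < w(E) < ∞` is needed.
  rw [← ENNReal.mul_le_mul_iff_left hs0 hs_fin]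
  refine le_trans (le_of_eq ?_) hchain
  rw [mul_assoc, ← ENNReal.rpow_add _ _ hE0 hEtop,
    show 1 / p + 1 / (p / (p - 1)) = 1 by field_simp; ring, ENNReal.rpow_one]

theorem cubeMaximal_one_le (x : Fin n → ℝ) :
    cubeMaximal (fun _ => (1 : ℝ≥0∞)) x ≤ 1 * 1 := by
  refine ballSup_le fun y r hx => ?_
  rw [setLAverage_const (measure_ball_pos _ _ (pos_of_mem_ball hx)).ne' measure_ball_lt_top.ne,
    mul_one]

/-- Serves the case `f = 0` a.e., where the algorithm yields no weight: tested with the weight `1`,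
the hypothesis forces the level sets of `g` to be null. -/
theorem isAp_one {p₀ : ℝ} (hp₀ : 1 ≤ p₀) : IsAp p₀ (fun _ : Fin n → ℝ => (1 : ℝ≥0∞)) := by
  have h1 : ¬ (fun _ : Fin n → ℝ => (1 : ℝ≥0∞)) =ᵐ[volume] 0 := by
    intro h
    obtain ⟨x, hx⟩ := h.exists
    simp at hx
  simpa using (isAp_factored hp₀ (F := fun _ : Fin n → ℝ => (1 : ℝ≥0∞)) (u := fun _ => 1)
    measurable_const measurable_const h1 h1 (by simp) (by simp) (c₁ := 1) (c₂ := 1)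
    one_ne_zero ENNReal.one_ne_top one_ne_zero ENNReal.one_ne_top cubeMaximal_one_le
    cubeMaximal_one_le).1

theorem ApConst_congr_ae {p : ℝ} (hp : 1 < p) {w w' : (Fin n → ℝ) → ℝ≥0∞}
    (h : w =ᵐ[volume] w') : ApConst p w = ApConst p w' := by
  have h' : (fun x => w x ^ (-1 / (p - 1))) =ᵐ[volume] fun x => w' x ^ (-1 / (p - 1)) := by
    filter_upwards [h] with x hx
    rw [hx]
  have e : ∀ Q : Set (Fin n → ℝ), ⨍⁻ x in Q, w x ∂volume = ⨍⁻ x in Q, w' x ∂volume := fun _ =>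
    laverage_congr (ae_restrict_of_ae h)
  have e' : ∀ Q : Set (Fin n → ℝ), ⨍⁻ x in Q, w x ^ (-1 / (p - 1)) ∂volume =
      ⨍⁻ x in Q, w' x ^ (-1 / (p - 1)) ∂volume := fun _ => laverage_congr (ae_restrict_of_ae h')
  simp only [ApConst, if_neg hp.ne', e, e']

/-- A weight agrees almost everywhere with a measurable function with values in `(0, ∞)`. -/
theorem IsWeight.exists_measurable_pos {w : (Fin n → ℝ) → ℝ≥0∞} (hw : IsWeight w) :
    ∃ w' : (Fin n → ℝ) → ℝ≥0∞, Measurable w' ∧ (∀ x, w' x ≠ 0) ∧ (∀ x, w' x ≠ ∞) ∧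
      w =ᵐ[volume] w' := by
  have hfin : ∀ᵐ x, w x < ∞ := by
    have : ∀ k : ℕ, ∀ᵐ x ∂volume.restrict (closedBall (0 : Fin n → ℝ) k), w x < ∞ := fun k =>
      ae_lt_top' hw.aemeasurable.restrict
        (hw.locallyIntegrable _ (isCompact_closedBall _ _)).ne
    rw [← ae_restrict_iUnion_iff, iUnion_closedBall_nat, Measure.restrict_univ] at this
    exact this
  set v := hw.aemeasurable.mk w with hv
  have hvm : Measurable v := hw.aemeasurable.measurable_mk
  set S : Set (Fin n → ℝ) := {x | v x ≠ 0} ∩ {x | v x ≠ ∞} with hS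
  have hSm : MeasurableSet S :=
    (hvm (measurableSet_singleton 0)).compl.inter (hvm (measurableSet_singleton ∞)).compl
  classical
  refine ⟨S.piecewise v 1, hvm.piecewise hSm measurable_one, fun x => ?_, fun x => ?_, ?_⟩
  · by_cases hx : x ∈ S
    · rw [piecewise_eq_of_mem _ _ _ hx]; exact hx.1
    · rw [piecewise_eq_of_notMem _ _ _ hx]; simp
  · by_cases hx : x ∈ S
    · rw [piecewise_eq_of_mem _ _ _ hx]; exact hx.2
    · rw [piecewise_eq_of_notMem _ _ _ hx]; simp
  · filter_upwards [hfin, hw.ae_pos, hw.aemeasurable.ae_eq_mk] with x h1 h2 h3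
    have hx : x ∈ S := ⟨by rw [mem_ofPred_eq, hv, ← h3]; exact h2.ne',
      by rw [mem_ofPred_eq, hv, ← h3]; exact h1.ne⟩
    rw [piecewise_eq_of_mem _ _ _ hx]
    exact h3

end Extrapolation

/-! ### The extrapolation theorem -/

theorem theorem3p1 (n : ℕ) (hn : 0 < n) (p₀ p : ℝ) (hp₀ : 1 ≤ p₀) (hp : 1 < p)
    (φ : ℝ≥0 → ℝ≥0) (hφ : IsLocBdd φ) :
    ∃ C : ℝ≥0 → ℝ≥0, ∀ f g : (Fin n → ℝ) → ℝ≥0∞,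
      AEMeasurable f volume → AEMeasurable g volume →
      (∀ w : (Fin n → ℝ) → ℝ≥0∞, IsAp p₀ w →
        weakLpNorm p₀ w g ≤ (φ (ApConst p₀ w).toNNReal : ℝ≥0∞) * strongLpNorm p₀ w f) →
      ∀ w : (Fin n → ℝ) → ℝ≥0∞, IsAp p w →
        weakLpNorm p w g ≤ (C (ApConst p w).toNNReal : ℝ≥0∞) * strongLpNorm p w f := by
  have hp0 : 0 < p := by linarith
  have hp₀0 : 0 < p₀ := by linarith
  choose B hB using hφ
  -- Local boundedness controls `φ` on the open interval `(0, T)` only: the `+ 1` makes the upper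
  -- bound strict, and `φ 0` is added below to cover the value at zero.
  let T : ℝ≥0 → ℝ≥0 := fun t => (extrapolationWeightBound n p₀ p t).toNNReal + 1
  let Φ : ℝ≥0 → ℝ≥0 := fun t => B (T t) + φ 0
  have hΦ : ∀ t s : ℝ≥0, (s : ℝ≥0∞) ≤ extrapolationWeightBound n p₀ p t → φ s ≤ Φ t := by
    intro t s hs
    rcases eq_zero_or_pos s with rfl | hs0
    · exact le_add_self
    · refine (hB (T t) (mem_image_of_mem φ ⟨hs0, ?_⟩)).trans le_self_add
      have := ENNReal.toNNReal_mono
        (extrapolationWeightBound_ne_top n hp₀ hp ENNReal.coe_ne_top) hs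
      rw [ENNReal.toNNReal_coe] at this
      exact this.trans_lt (lt_add_one _)
  -- The `+ 1` keeps the constant positive, so the right side is `∞` when the norm of `f` is, even
  -- if `Φ` vanishes.
  refine ⟨fun t => 4 * Φ t + 1, fun f g hf hg hfg w hw => ?_⟩
  obtain ⟨w', hwm, hw0, hwtop, hww⟩ := hw.1.exists_measurable_pos
  have hK : ApConst p w = ApConst p w' := ApConst_congr_ae hp hww
  have hKtop : ApConst p w' ≠ ∞ := hK ▸ hw.2.ne
  have hff := hf.ae_eq_mk
  set f' := hf.mk f
  have hgg := hg.ae_eq_mk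
  set g' := hg.mk g
  have hfm : Measurable f' := hf.measurable_mk
  have hgm : Measurable g' := hg.measurable_mk
  have hstrong : ∀ (q : ℝ) (v : (Fin n → ℝ) → ℝ≥0∞),
      strongLpNorm q v f = (∫⁻ x, f' x ^ q * v x) ^ (1 / q) := by
    intro q v
    rw [strongLpNorm]
    congr 1
    refine lintegral_congr_ae ?_
    filter_upwards [hff] with x hx
    rw [hx]
  have hstrongw : strongLpNorm p w f = (∫⁻ x, f' x ^ p * w' x) ^ (1 / p) := by
    rw [hstrong]
    congr 1
    refine lintegral_congr_ae ?_
    filter_upwards [hww] with x hx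
    rw [hx]
  -- The hypothesis passes to measurable subsets of the level set, and to measurable representatives
  -- because `W dx` is absolutely continuous.
  have hweak : ∀ (y : ℝ≥0), 0 < y → ∀ E : Set (Fin n → ℝ), MeasurableSet E →
      E ⊆ {x | (y : ℝ≥0∞) < g' x} → ∀ W : (Fin n → ℝ) → ℝ≥0∞, IsAp p₀ W →
      (y : ℝ≥0∞) * (∫⁻ x in E, W x) ^ (1 / p₀) ≤
        (φ (ApConst p₀ W).toNNReal : ℝ≥0∞) * (∫⁻ x, f' x ^ p₀ * W x) ^ (1 / p₀) := by
    intro y hy E hE hEg W hW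
    rw [← hstrong]
    refine le_trans ?_ (hfg W hW)
    refine le_trans ?_ (le_iSup₂ (f := fun (y : ℝ≥0) (_ : 0 < y) =>
      (y : ℝ≥0∞) * distribFun W g y ^ (1 / p₀)) y hy)
    refine mul_le_mul' le_rfl (ENNReal.rpow_le_rpow ?_ (by positivity))
    rw [← withDensity_apply _ hE, distribFun]
    refine measure_mono_ae ?_
    filter_upwards [(withDensity_absolutelyContinuous volume W).ae_le hgg] with x hx hxE
    have := hEg hxE
    rw [mem_ofPred_eq, ← hx] at this
    exact this
  have hset : ∀ (y : ℝ≥0), 0 < y → ∀ E : Set (Fin n → ℝ), MeasurableSet E →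
      E ⊆ {x | (y : ℝ≥0∞) < g' x} → ∫⁻ x in E, w' x ≠ ∞ →
      (y : ℝ≥0∞) * (∫⁻ x in E, w' x) ^ (1 / p) ≤
        ((4 * Φ (ApConst p w).toNNReal + 1 : ℝ≥0) : ℝ≥0∞) *
          (∫⁻ x, f' x ^ p * w' x) ^ (1 / p) := by
    intro y hy E hE hEg hEtop
    by_cases hf0 : f' =ᵐ[volume] 0
    · have h1 := hweak y hy E hE hEg _ (isAp_one hp₀)
      have h2 : ∫⁻ x, f' x ^ p₀ * 1 = 0 := by
        rw [lintegral_eq_zero_iff (by fun_prop)]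
        filter_upwards [hf0] with x hx
        simp [hx, hp₀0]
      have hvol : volume E = 0 := by
        rw [h2, ENNReal.zero_rpow_of_pos (by positivity), mul_zero, nonpos_iff_eq_zero] at h1
        simpa [hy.ne', hp₀0, hp₀0.not_gt] using h1
      rw [Measure.restrict_eq_zero.2 hvol, lintegral_zero_measure,
        ENNReal.zero_rpow_of_pos (by positivity), mul_zero]
      exact zero_le
    by_cases hftop : ∫⁻ x, f' x ^ p * w' x = ∞
    · rw [hftop, ENNReal.top_rpow_of_pos (by positivity), ENNReal.mul_top (by positivity)]
      exact le_top
    refine (extrapolation_of_set (Φ := (Φ (ApConst p w).toNNReal : ℝ≥0∞)) hp₀ hp hwm hw0 hwtop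
      hKtop hfm hf0 hftop hE hEtop fun W hW hWC => ?_).trans ?_
    · refine (hweak y hy E hE hEg W hW).trans (mul_le_mul' ?_ le_rfl)
      refine ENNReal.coe_le_coe.2 (hΦ _ _ ?_)
      rwa [ENNReal.coe_toNNReal hW.2.ne, ENNReal.coe_toNNReal hw.2.ne, hK]
    · refine mul_le_mul' ?_ le_rfl
      push_cast
      exact le_self_add
  rw [hstrongw]
  refine iSup₂_le fun y hy => ?_
  -- Intersecting with bounded sets makes `w(E)` finite by local integrability; the bound is uniform
  -- in `k`, so the supremum is harmless.
  set E : ℕ → Set (Fin n → ℝ) := fun k =>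
    {x | (y : ℝ≥0∞) < g' x} ∩ closedBall (0 : Fin n → ℝ) k with hEdef
  have hEm : ∀ k, MeasurableSet (E k) := fun k =>
    (measurableSet_lt measurable_const hgm).inter measurableSet_closedBall
  have hEmono : Monotone E := fun j k hjk =>
    inter_subset_inter_right _ (closedBall_subset_closedBall (by exact_mod_cast hjk))
  have hEunion : ⋃ k, E k = {x | (y : ℝ≥0∞) < g' x} := by
    rw [hEdef, ← inter_iUnion, iUnion_closedBall_nat, inter_univ]
  have hdist : distribFun w g y = ⨆ k, ∫⁻ x in E k, w' x := by
    simp_rw [← withDensity_apply w' (hEm _)]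
    rw [← hEmono.measure_iUnion, hEunion, distribFun, withDensity_congr_ae hww]
    refine measure_congr (Filter.eventuallyEq_set.2 ?_)
    filter_upwards [(withDensity_absolutelyContinuous volume w').ae_le hgg] with x hx
    rw [hx]
  have hp_inv : 0 < 1 / p := by positivity
  rw [hdist, show (⨆ k, ∫⁻ x in E k, w' x) ^ (1 / p) = ⨆ k, (∫⁻ x in E k, w' x) ^ (1 / p) from
    (ENNReal.orderIsoRpow (1 / p) hp_inv).map_iSup _, ENNReal.mul_iSup]
  refine iSup_le fun k => hset y hy (E k) (hEm k) inter_subset_left ?_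
  have hlt := hw.1.locallyIntegrable _ (isCompact_closedBall (0 : Fin n → ℝ) (k : ℝ))
  rw [lintegral_congr_ae (ae_restrict_of_ae hww)] at hlt
  exact ((lintegral_mono_set inter_subset_right).trans_lt hlt).ne
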